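/- Let $d\ge 1$, let $\Omega\subset\mathbb R^d$ be open and bounded, and let $\theta$ range over the unit sphere $\mathbb S^{d-1}$. *Notation.* $W_\theta(\Omega)$ is the set of $u\in L^2(\Omega)$ that have a weak derivative $\partial_\theta u\in L^2(\Omega)$ along $\theta$, i.e. $\int_\Omega u\,\theta\cdot\nabla\varphi=-\int_\Omega \partial_\theta u\,\varphi$ for all $\varphi\in C_c^\infty(\Omega)$. For $x\in\Omega$ let $\delta_\theta(x)=\sup\{s\ge0:\ x+t\theta\in\Omega\ \forall t\in[0,s)\}$ and $\Phi_\theta(x)=x+\delta_\theta(x)\theta$; let $\partial_\theta\Omega=\Phi_\theta(\Omega)\subset\partial\Omega$, and let $\mu_\theta$ be the image under $\Phi_\theta$ of Lebesgue measure on $\Omega$. For $z=\Phi_\theta(x)\in\partial_\theta\Omega$ let $\ell_{-\theta}(z)=\delta_\theta(x)+\delta_{-\theta}(x)$ (the length of the chord of $\Omega$ parallel to $\theta$ that ends at $z$). For $y\in\theta^\perp$ let $\omega_\theta(y)=\{s\in\mathbb R: s\theta+y\in\Omega\}$, and let $P_\theta$ be the orthogonal projection onto $\theta^\perp$. A function $g:\partial\Omega\to\mathbb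 R$ is a *directional trace* of $u\in W_\theta(\Omega)$ in the direction $\theta$, written $g=\gamma_\theta u$, if for some representative of $u$ and for $\lambda^{d-1}$-a.e. $y\in P_\theta(\Omega)$ the function $s\mapsto u(s\theta+y)$ belongs to $H^1(\omega_\theta(y))$ and, for each component $(\alpha,\beta)$ of $\omega_\theta(y)$, its representative on $(\alpha,\beta)$ that is continuous on $(\alpha,\beta]$ takes the value $g(\beta\theta+y)$ at $\beta$. $L^2(\partial\Omega,(\mu_\theta)_\theta)$ is the set of $g:\partial\Omega\to\mathbb R$ that are in $L^2(\mu_\theta)$ for every $\theta$ with norms bounded independently of $\theta$. $H^1_{\rm tr}(\Omega)$ is the set of $u\in H^1(\Omega)$ for which there is $g=:{\rm tr}(u)$ in this space with $\gamma_\theta u=g$ $\mu_\theta$-a.e. for every $\theta\in\mathbb S^{d-1}$. For $\varepsilon>0$ put $$u_{\theta,\varepsilon}(z)=\frac1{\min(\varepsilon,\ell_{-\theta}(z))}\int_0^{\min(\varepsilon,\ell_{-\theta}(z))}u(z-s\theta)\,ds .$$ **Theorem.** 1. Let $\theta\in\mathbb S^{d-1}$ and $u\in W_\theta(\Omega)$.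 Then $u$ has a directional trace in the direction $\theta$. For $\mu_\theta$-a.e. $z\in\partial_\theta\Omega$ we have $\ell_{-\theta}(z)>0$ and $s\mapsto u(z-s\theta)$ is integrable on $(0,\ell_{-\theta}(z))$, so that $u_{\theta,\varepsilon}(z)$ is well defined for all $\varepsilon>0$. For every directional trace $\gamma_\theta u$ of $u$, $$\lim_{\varepsilon\to0^+}u_{\theta,\varepsilon}(z)=\gamma_\theta u(z)\quad\text{for }\mu_\theta\text{-a.e. }z\in\partial_\theta\Omega,$$ and, for every $\varepsilon>0$, $\gamma_\theta u-u_{\theta,\varepsilon}\in L^2(\partial_\theta\Omega,\mu_\theta)$ and $$\int_{\partial_\theta\Omega}\big(\gamma_\theta u(z)-u_{\theta,\varepsilon}(z)\big)^2\,d\mu_\theta(z)\le\varepsilon\,{\rm diam}(\Omega)\,\|\partial_\theta u\|_{L^2(\Omega)}^2 .$$ 2. Let $u\in H^1_{\rm tr}(\Omega)$. Then for every $\theta\in\mathbb S^{d-1}$ and $\mu_\theta$-a.e. $z\in\partial_\theta\Omega$ the averages $u_{\theta,\varepsilon}(z)$ are well defined in the above sense and $\lim_{\varepsilon\to0^+}u_{\theta,\varepsilon}(z)={\rm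 tr}(u)(z)$. Moreover, for every $\varepsilon>0$, the functions ${\rm tr}(u)-u_{\theta,\varepsilon}$ belong to $L^2(\partial_\theta\Omega,\mu_\theta)$ for every $\theta\in\mathbb S^{d-1}$, and $$\sup_{\theta\in\mathbb S^{d-1}}\int_{\partial_\theta\Omega}\big({\rm tr}(u)(z)-u_{\theta,\varepsilon}(z)\big)^2\,d\mu_\theta(z)\le\varepsilon\,{\rm diam}(\Omega)\,\|\nabla u\|_{L^2(\Omega)}^2 .$$ -/

import Mathlib

open MeasureTheory Set Filter Topology
open scoped ContDiff RealInnerProductSpace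

namespace DirTrace

noncomputable section

/-! ### Weak directional derivatives, `W_θ(Ω)` and `H¹(Ω)` -/

section Weak

variable {E : Type*} [NormedAddCommGroup E] [NormedSpace ℝ E] [MeasureSpace E]

/-- `v ∈ L²(Ω)` is the weak derivative of `u` along `θ` in the open set `Ω`:
`∫_Ω u ∂_θ φ = - ∫_Ω v φ` for all `φ ∈ C^∞_c(Ω)`. -/
def IsWeakDirDeriv (Ω : Set E) (θ : E) (u v : E → ℝ) : Prop :=
  MemLp v 2 (volume.restrict Ω) ∧
    ∀ φ : E → ℝ, ContDiff ℝ ∞ φ → HasCompactSupport φ → tsupport φ ⊆ Ω →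
      ∫ x in Ω, u x * fderiv ℝ φ x θ = - ∫ x in Ω, v x * φ x

/-- `u ∈ W_θ(Ω)`: both `u` and its weak derivative along `θ` belong to `L²(Ω)`. -/
def MemW (Ω : Set E) (θ : E) (u : E → ℝ) : Prop :=
  MemLp u 2 (volume.restrict Ω) ∧ ∃ v : E → ℝ, IsWeakDirDeriv Ω θ u v

end Weak

/-- `f ∈ H¹(S)` for an open set `S ⊆ ℝ`. -/
def MemH1Line (S : Set ℝ) (f : ℝ → ℝ) : Prop := MemW S (1 : ℝ) f

variable {d : ℕ}

/-- `G = ∇u ∈ L²(Ω)^d` in the weak sense: the `i`-th component of `G` is the weak `i`-th partial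
derivative of `u`. -/
def IsWeakGrad (Ω : Set (EuclideanSpace ℝ (Fin d))) (u : EuclideanSpace ℝ (Fin d) → ℝ)
    (G : EuclideanSpace ℝ (Fin d) → EuclideanSpace ℝ (Fin d)) : Prop :=
  ∀ i : Fin d, IsWeakDirDeriv Ω (EuclideanSpace.single i (1 : ℝ)) u (fun x => G x i)

/-- `u ∈ H¹(Ω)`. -/
def MemH1 (Ω : Set (EuclideanSpace ℝ (Fin d))) (u : EuclideanSpace ℝ (Fin d) → ℝ) : Prop :=
  MemLp u 2 (volume.restrict Ω) ∧ ∃ G, IsWeakGrad Ω u G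

/-! ### Geometry of `Ω` in the direction `θ` -/

/-- `δ_θ(x) = sup {s ≥ 0 : ∀ t ∈ [0, s[, x + t θ ∈ Ω}`. -/
def delta (Ω : Set (EuclideanSpace ℝ (Fin d))) (θ x : EuclideanSpace ℝ (Fin d)) : ℝ :=
  sSup {s : ℝ | 0 ≤ s ∧ ∀ t ∈ Ico 0 s, x + t • θ ∈ Ω}

/-- `Φ_θ(x) = x + δ_θ(x) θ`. -/
def Phi (Ω : Set (EuclideanSpace ℝ (Fin d))) (θ x : EuclideanSpace ℝ (Fin d)) :
    EuclideanSpace ℝ (Fin d) :=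
  x + delta Ω θ x • θ

/-- `∂_θ Ω = Φ_θ(Ω)`, the part of the boundary seen from `Ω` in the direction `θ`. -/
def dirBoundary (Ω : Set (EuclideanSpace ℝ (Fin d))) (θ : EuclideanSpace ℝ (Fin d)) :
    Set (EuclideanSpace ℝ (Fin d)) :=
  Phi Ω θ '' Ω

/-- For `z ∈ ∂_θ Ω`, this is `ℓ_{-θ}(z)`, the length of the chord of `Ω` parallel to `θ` that ends
at `z`; see `chordLength_Phi`. -/
def chordLength (Ω : Set (EuclideanSpace ℝ (Fin d))) (θ z : EuclideanSpace ℝ (Fin d)) : ℝ :=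
  sSup {s : ℝ | 0 ≤ s ∧ ∀ t ∈ Ioo 0 s, z - t • θ ∈ Ω}

/-- The directional measure `μ_θ(A) = ∫_Ω χ_A(Φ_θ(x)) dx`, regarded as a measure on the whole
space (it is carried by `∂_θ Ω ⊆ ∂Ω`); see `dirMeasure_apply`. -/
def dirMeasure (Ω : Set (EuclideanSpace ℝ (Fin d))) (θ : EuclideanSpace ℝ (Fin d)) :
    Measure (EuclideanSpace ℝ (Fin d)) :=
  Measure.map (Phi Ω θ) (volume.restrict Ω)

/-- The hyperplane `H_θ` orthogonal to `θ`. -/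
abbrev hyp (θ : EuclideanSpace ℝ (Fin d)) : Submodule ℝ (EuclideanSpace ℝ (Fin d)) :=
  (Submodule.span ℝ {θ})ᗮ

/-- The Lebesgue measure `λ^{d-1}` on the hyperplane `H_θ`. -/
def hypMeasure (θ : EuclideanSpace ℝ (Fin d)) : Measure (hyp θ) :=
  (stdOrthonormalBasis ℝ (hyp θ)).toBasis.addHaar

/-- `P_θ(Ω)`, the image of `Ω` by the orthogonal projection `x ↦ x - (x · θ) θ` onto `H_θ`. -/
def projSet (Ω : Set (EuclideanSpace ℝ (Fin d))) (θ : EuclideanSpace ℝ (Fin d)) : Set (hyp θ) :=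
  {y | ∃ x ∈ Ω, (y : EuclideanSpace ℝ (Fin d)) = x - ⟪x, θ⟫ • θ}

/-- `ω_θ(y) = {s ∈ ℝ : s θ + y ∈ Ω}`. -/
def slice (Ω : Set (EuclideanSpace ℝ (Fin d))) (θ y : EuclideanSpace ℝ (Fin d)) : Set ℝ :=
  {s | s • θ + y ∈ Ω}

/-- `]α, β[` is one of the disjoint bounded open intervals that make up the bounded open
set `S ⊆ ℝ`. -/
def IsComponentInterval (S : Set ℝ) (α β : ℝ) : Prop :=
  α < β ∧ Ioo α β ⊆ S ∧ α ∉ S ∧ β ∉ S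

/-! ### Directional and omnidirectional traces

Functions on `∂Ω` are represented by functions on the whole space, of which only the values on
`∂Ω` matter. -/

/-- `g` is a directional trace of `u` in the direction `θ`: for some representative `w` of `u` and
`λ^{d-1}`-a.e. `y ∈ P_θ(Ω)`, the restriction of `w` to the line through `y` is in `H¹(ω_θ(y))`,
and on each interval `]α, β[` of `ω_θ(y)` its representative that is continuous on `]α, β]` takes
the value `g(β θ + y)` at `β`. -/
def IsDirTrace (Ω : Set (EuclideanSpace ℝ (Fin d))) (θ : EuclideanSpace ℝ (Fin d))
    (u g : EuclideanSpace ℝ (Fin d) → ℝ) : Prop :=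
  ∃ w : EuclideanSpace ℝ (Fin d) → ℝ, w =ᵐ[volume.restrict Ω] u ∧
    ∃ A : Set (hyp θ), A ⊆ projSet Ω θ ∧ hypMeasure θ (projSet Ω θ \ A) = 0 ∧
      ∀ y ∈ A,
        MemH1Line (slice Ω θ y) (fun s => w (s • θ + y)) ∧
        ∀ α β : ℝ, IsComponentInterval (slice Ω θ y) α β →
          ∃ f : ℝ → ℝ, f =ᵐ[volume.restrict (Ioo α β)] (fun s => w (s • θ + y)) ∧
            ContinuousOn f (Ioc α β) ∧ g (β • θ + y) = f β

/-- `g` belongs to `L²(∂Ω, (μ_θ)_θ)`: it is in `L²(μ_θ)` for every unit vector `θ`, with a norm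
bounded independently of `θ`. -/
def MemL2Family (Ω : Set (EuclideanSpace ℝ (Fin d))) (g : EuclideanSpace ℝ (Fin d) → ℝ) : Prop :=
  ∃ M : ℝ, 0 ≤ M ∧ ∀ θ ∈ Metric.sphere (0 : EuclideanSpace ℝ (Fin d)) 1,
    MemLp g 2 (dirMeasure Ω θ) ∧ ∫ z, g z ^ 2 ∂(dirMeasure Ω θ) ≤ M

/-- `g = tr(u)` is the omnidirectional trace of `u`: it belongs to `L²(∂Ω, (μ_θ)_θ)` and
`γ_θ u = g` `μ_θ`-a.e. for every unit vector `θ`. -/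
def IsOmniTrace (Ω : Set (EuclideanSpace ℝ (Fin d))) (u g : EuclideanSpace ℝ (Fin d) → ℝ) : Prop :=
  MemL2Family Ω g ∧ ∀ θ ∈ Metric.sphere (0 : EuclideanSpace ℝ (Fin d)) 1,
    ∃ γ : EuclideanSpace ℝ (Fin d) → ℝ, IsDirTrace Ω θ u γ ∧ γ =ᵐ[dirMeasure Ω θ] g

/-- `u ∈ H¹_tr(Ω)`: `u ∈ H¹(Ω)` has an omnidirectional trace. -/
def MemH1tr (Ω : Set (EuclideanSpace ℝ (Fin d))) (u : EuclideanSpace ℝ (Fin d) → ℝ) : Prop :=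
  MemH1 Ω u ∧ ∃ g, IsOmniTrace Ω u g

/-- The one-sided average
`u_{θ,ε}(z) = (1 / min(ε, ℓ_{-θ}(z))) ∫_0^{min(ε, ℓ_{-θ}(z))} u(z - s θ) ds`. -/
def dirAverage (Ω : Set (EuclideanSpace ℝ (Fin d))) (θ : EuclideanSpace ℝ (Fin d))
    (u : EuclideanSpace ℝ (Fin d) → ℝ) (ε : ℝ) (z : EuclideanSpace ℝ (Fin d)) : ℝ :=
  1 / min ε (chordLength Ω θ z) * ∫ s in (0 : ℝ)..min ε (chordLength Ω θ z), u (z - s • θ)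

/-! ### The definitions of `μ_θ` and of the chord length are meaningful -/

variable {Ω : Set (EuclideanSpace ℝ (Fin d))} {θ : EuclideanSpace ℝ (Fin d)}

theorem le_diam_of_mem (hb : Bornology.IsBounded Ω) (hθ : ‖θ‖ = 1)
    {x : EuclideanSpace ℝ (Fin d)} {s : ℝ} (hs : ∀ t ∈ Ioo 0 s, x + t • θ ∈ Ω) :
    s ≤ Metric.diam Ω := by
  by_contra! h
  have h0 : 0 ≤ Metric.diam Ω := Metric.diam_nonneg
  set D := Metric.diam Ω
  have h1 := hs ((s - D) / 3) ⟨by linarith, by linarith⟩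
  have h2 := hs ((s - D) / 2 + D) ⟨by linarith, by linarith⟩
  have h3 := Metric.dist_le_diam_of_mem hb h2 h1
  rw [dist_add_left, dist_eq_norm, ← sub_smul, norm_smul, hθ, mul_one, Real.norm_eq_abs] at h3
  have h4 := (le_abs_self _).trans h3
  change _ ≤ D at h4
  linarith

theorem bddAbove_delta (hb : Bornology.IsBounded Ω) (hθ : ‖θ‖ = 1)
    (x : EuclideanSpace ℝ (Fin d)) :
    BddAbove {s : ℝ | 0 ≤ s ∧ ∀ t ∈ Ico 0 s, x + t • θ ∈ Ω} :=
  ⟨Metric.diam Ω, fun _ hs => le_diam_of_mem hb hθ fun t ht => hs.2 t ⟨ht.1.le, ht.2⟩⟩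

theorem nonempty_delta (x : EuclideanSpace ℝ (Fin d)) :
    {s : ℝ | 0 ≤ s ∧ ∀ t ∈ Ico 0 s, x + t • θ ∈ Ω}.Nonempty :=
  ⟨0, le_refl _, fun _ h => absurd h.2 (not_lt.2 h.1)⟩

theorem delta_nonneg (x : EuclideanSpace ℝ (Fin d)) : 0 ≤ delta Ω θ x :=
  Real.sSup_nonneg fun _ hs => hs.1

theorem lowerSemicontinuous_delta (ho : IsOpen Ω) (hb : Bornology.IsBounded Ω) (hθ : ‖θ‖ = 1) :
    LowerSemicontinuous (delta Ω θ) := by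
  intro x l hl
  rcases lt_or_ge l 0 with h0 | h0
  · exact Eventually.of_forall fun x' => h0.trans_le (delta_nonneg x')
  · obtain ⟨s, hs, hls⟩ := exists_lt_of_lt_csSup (nonempty_delta x) hl
    obtain ⟨m, hm1, hm2⟩ := exists_between hls
    have : ∀ᶠ x' in 𝓝 x, ∀ t ∈ Icc 0 m, x' + t • θ ∈ Ω := by
      refine isCompact_Icc.eventually_forall_of_forall_eventually fun t ht => ?_
      have hc : Continuous fun p : EuclideanSpace ℝ (Fin d) × ℝ => p.1 + p.2 • θ := by fun_prop
      exact hc.continuousAt.eventually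
        (ho.mem_nhds (hs.2 t ⟨ht.1, ht.2.trans_lt hm2⟩))
    filter_upwards [this] with x' hx'
    exact hm1.trans_le (le_csSup (bddAbove_delta hb hθ x')
      ⟨h0.trans hm1.le, fun t ht => hx' t ⟨ht.1, ht.2.le⟩⟩)

theorem measurable_Phi (ho : IsOpen Ω) (hb : Bornology.IsBounded Ω) (hθ : ‖θ‖ = 1) :
    Measurable (Phi Ω θ) :=
  measurable_id.add ((lowerSemicontinuous_delta ho hb hθ).measurable.smul_const θ)

theorem dirMeasure_apply (ho : IsOpen Ω) (hb : Bornology.IsBounded Ω) (hθ : ‖θ‖ = 1)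
    {A : Set (EuclideanSpace ℝ (Fin d))} (hA : MeasurableSet A) :
    dirMeasure Ω θ A = ∫⁻ x in Ω, A.indicator 1 (Phi Ω θ x) := by
  rw [← lintegral_map (measurable_one.indicator hA) (measurable_Phi ho hb hθ),
    lintegral_indicator_one hA, dirMeasure]

theorem add_mem_of_lt_delta {x : EuclideanSpace ℝ (Fin d)} {t : ℝ} (h0 : 0 ≤ t)
    (ht : t < delta Ω θ x) : x + t • θ ∈ Ω := by
  obtain ⟨s, hs, hts⟩ := exists_lt_of_lt_csSup (nonempty_delta x) ht
  exact hs.2 t ⟨h0, hts⟩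

theorem add_delta_notMem (ho : IsOpen Ω) (hb : Bornology.IsBounded Ω) (hθ : ‖θ‖ = 1)
    (x : EuclideanSpace ℝ (Fin d)) : Phi Ω θ x ∉ Ω := by
  intro h
  have hc : Continuous fun t : ℝ => x + t • θ := by fun_prop
  obtain ⟨r, hr, hball⟩ := Metric.isOpen_iff.1 (ho.preimage hc) (delta Ω θ x) h
  have hle : delta Ω θ x + r / 2 ≤ delta Ω θ x := by
    refine le_csSup (bddAbove_delta hb hθ x) ⟨by linarith [delta_nonneg (Ω := Ω) (θ := θ) x], ?_⟩
    intro t ht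
    rcases lt_or_ge t (delta Ω θ x) with h1 | h1
    · exact add_mem_of_lt_delta ht.1 h1
    · refine hball ?_
      rw [Metric.mem_ball, Real.dist_eq, abs_of_nonneg (by linarith)]
      linarith [ht.2]
  linarith

/-- If `z = Φ_θ(x)` with `x ∈ Ω`, then `ℓ_{-θ}(z) = δ_θ(x) + δ_{-θ}(x)`. -/
theorem chordLength_Phi (ho : IsOpen Ω) (hb : Bornology.IsBounded Ω) (hθ : ‖θ‖ = 1)
    {x : EuclideanSpace ℝ (Fin d)} (hx : x ∈ Ω) :
    chordLength Ω θ (Phi Ω θ x) = delta Ω θ x + delta Ω (-θ) x := by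
  have e : ∀ t : ℝ, Phi Ω θ x - t • θ = x + (delta Ω θ x - t) • θ := fun t => by
    rw [Phi, sub_smul]; abel
  have e' : ∀ t : ℝ, Phi Ω θ x - t • θ = x + (t - delta Ω θ x) • (-θ) := fun t => by
    rw [e, smul_neg, ← neg_smul, neg_sub]
  have hpos : 0 < delta Ω θ x := by
    refine (delta_nonneg x).lt_of_ne fun h => add_delta_notMem ho hb hθ x ?_
    rw [Phi, ← h]; simpa using hx
  have hn := delta_nonneg (Ω := Ω) (θ := -θ) x
  refine IsGreatest.csSup_eq ⟨⟨by linarith, fun t ht => ?_⟩, fun s hs => ?_⟩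
  · rcases le_or_gt t (delta Ω θ x) with h | h
    · rw [e]; exact add_mem_of_lt_delta (by linarith) (by linarith [ht.1])
    · rw [e']; exact add_mem_of_lt_delta (by linarith) (by linarith [ht.2])
  · by_contra! h
    have := hs.2 (delta Ω θ x + delta Ω (-θ) x) ⟨by linarith, h⟩
    rw [e', add_sub_cancel_left] at this
    exact add_delta_notMem ho hb (by rwa [norm_neg]) x this

end

end DirTrace

/-! Along almost every line parallel to `θ`, `u` is a primitive of `v = ∂_θ u`, and everything
follows from this one-dimensional fact. To obtain it, the weak derivative is tested with translates
of `φ`: the derivative in `t` of `∫ u(x) φ(x - tθ) dx` is `∫ v(x) φ(x - tθ) dx`, and integration in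
`t` gives `u(x + tθ) - u(x) = ∫_0^t v(x + sθ) ds` for a.e. `x` whose segment stays in `Ω`
(`ae_sub_eq_integral_of_isWeakDirDeriv`). Fubini carries this to a.e. line (`ae_isSlicePrimitive`).

On a chord `(α, β)` the function is therefore continuous up to `β`, and by Cauchy-Schwarz the
squared difference between its value at `β` and its value at distance at most `ε` is at most `ε`
times the integral of `v²` over the chord. Averages inherit the bound
(`IsSlicePrimitive.sq_sub_average_le`), which gives both the existence of the trace and the
convergence of the averages.

Since `μ_θ` is the image of Lebesgue measure, integrating the bound over `∂_θ Ω` means integrating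
over `x ∈ Ω` the integral of `v²` over the chord through `x`. By Fubini a point of `Ω` is counted
with a weight equal to the length of a set of parameters contained in a slice of `Ω`, hence at most
`diam Ω` (`lintegral_lintegral_segment_le`). The second half of the theorem takes `v = θ · ∇u`, with
`|θ · ∇u| ≤ |∇u|`. -/

namespace DirTrace

set_option linter.unusedSectionVars false

/-! ### Weak derivatives as integral identities along segments. -/

section Translation

variable {E : Type*} [NormedAddCommGroup E] [NormedSpace ℝ E] [FiniteDimensional ℝ E]
  [MeasureSpace E] [BorelSpace E] [(volume : Measure E).IsAddHaarMeasure]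

theorem exists_bound_fderiv_apply {φ : E → ℝ} (hφ : ContDiff ℝ ∞ φ) (hc : HasCompactSupport φ)
    (θ : E) : ∃ C, ∀ x, ‖fderiv ℝ φ x θ‖ ≤ C := by
  have h1 : Continuous fun x => fderiv ℝ φ x θ :=
    (hφ.continuous_fderiv (by simp)).clm_apply continuous_const
  exact h1.bounded_above_of_compact_support (hc.fderiv_apply ℝ θ)

theorem hasDerivAt_translate {φ : E → ℝ} (hφ : ContDiff ℝ ∞ φ) (x θ : E) (t : ℝ) :
    HasDerivAt (fun t : ℝ => φ (x - t • θ)) (-fderiv ℝ φ (x - t • θ) θ) t := by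
  have h1 : HasDerivAt (fun t : ℝ => x - t • θ) (-θ) t := by
    simpa using ((hasDerivAt_id t).smul_const θ).const_sub x
  have h2 := ((hφ.differentiable (by simp)) (x - t • θ)).hasFDerivAt.comp_hasDerivAt t h1
  rwa [map_neg] at h2

theorem integrable_mul_translate {U φ : E → ℝ} (hU : Integrable U) (hφ : Continuous φ)
    (hc : HasCompactSupport φ) (a : E) : Integrable fun x => U x * φ (x - a) := by
  obtain ⟨C, hC⟩ := hφ.bounded_above_of_compact_support hc
  exact hU.mul_bdd (c := C) (by fun_prop) (Eventually.of_forall fun x => hC _)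

/-- Moving the test function instead of `U` lets one differentiate under the integral although `U`
is merely integrable; the dominating function is `‖U‖` times a bound of `∂_θ φ`. -/
theorem hasDerivAt_integral_translate {U φ : E → ℝ} (hU : Integrable U) (hφ : ContDiff ℝ ∞ φ)
    (hc : HasCompactSupport φ) (θ : E) (t : ℝ) :
    HasDerivAt (fun t : ℝ => ∫ x, U x * φ (x - t • θ))
      (∫ x, U x * -fderiv ℝ φ (x - t • θ) θ) t := by
  obtain ⟨C, hC⟩ := exists_bound_fderiv_apply hφ hc θ
  have hd : Continuous fun x => fderiv ℝ φ x θ :=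
    (hφ.continuous_fderiv (by simp)).clm_apply continuous_const
  refine (hasDerivAt_integral_of_dominated_loc_of_deriv_le (s := univ)
    (F := fun t x => U x * φ (x - t • θ)) (F' := fun t x => U x * -fderiv ℝ φ (x - t • θ) θ)
    (bound := fun x => ‖U x‖ * C)
    univ_mem ?_ ?_ ?_ ?_ ?_ ?_).2
  · exact Eventually.of_forall fun s =>
      (integrable_mul_translate hU hφ.continuous hc _).aestronglyMeasurable
  · exact integrable_mul_translate hU hφ.continuous hc _
  · refine hU.aestronglyMeasurable.mul (Continuous.aestronglyMeasurable ?_)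
    exact (hd.comp (continuous_id.sub continuous_const)).neg
  · refine Eventually.of_forall fun x s _ => ?_
    rw [norm_mul, norm_neg]
    exact mul_le_mul_of_nonneg_left (hC _) (norm_nonneg _)
  · exact hU.norm.mul_const C
  · exact Eventually.of_forall fun x s _ => (hasDerivAt_translate hφ x θ s).const_mul (U x)

theorem continuous_integral_translate {U φ : E → ℝ} (hU : Integrable U) (hφ : ContDiff ℝ ∞ φ)
    (hc : HasCompactSupport φ) (θ : E) : Continuous fun t : ℝ => ∫ x, U x * φ (x - t • θ) :=
  continuous_iff_continuousAt.2 fun t =>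
    (hasDerivAt_integral_translate hU hφ hc θ t).continuousAt

theorem integral_mul_translate_eq (U φ : E → ℝ) (a : E) :
    ∫ x, U x * φ (x - a) = ∫ x, φ x * U (x + a) := by
  rw [← integral_add_right_eq_self (μ := volume) (fun x => U x * φ (x - a)) a]
  simp [mul_comm]

theorem integrable_prod_translate {V : E → ℝ} (hm : StronglyMeasurable V) (hV : Integrable V)
    (θ : E) (t : ℝ) :
    Integrable (fun p : E × ℝ => V (p.1 + p.2 • θ))
      ((volume : Measure E).prod (volume.restrict (Ioc 0 t))) := by
  refine (integrable_prod_iff' ?_).2 ⟨?_, ?_⟩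
  · exact (hm.comp_measurable (by fun_prop)).aestronglyMeasurable
  · exact Eventually.of_forall fun s => hV.comp_add_right (s • θ)
  · simp_rw [fun y : ℝ => integral_add_right_eq_self (μ := volume) (fun x => ‖V x‖) (y • θ)]
    exact integrable_const _

theorem integral_integral_translate {V φ : E → ℝ} (hm : StronglyMeasurable V) (hV : Integrable V)
    (hφ : Continuous φ) (hc : HasCompactSupport φ) (θ : E) {t : ℝ} (ht : 0 ≤ t) :
    ∫ s in (0 : ℝ)..t, ∫ x, V x * φ (x - s • θ) =
      ∫ x, φ x * ∫ s in (0 : ℝ)..t, V (x + s • θ) := by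
  simp_rw [integral_mul_translate_eq, intervalIntegral.integral_of_le ht]
  rw [integral_integral_swap]
  · simp_rw [integral_const_mul]
  · obtain ⟨C, hC⟩ := hφ.bounded_above_of_compact_support hc
    have h := (integrable_prod_translate hm hV θ t).bdd_mul (c := C)
      (f := fun p : E × ℝ => φ p.1)
      (hφ.comp continuous_fst).aestronglyMeasurable (Eventually.of_forall fun p => hC _)
    exact h.swap

theorem isOpen_segment_subset {Ω : Set E} (ho : IsOpen Ω) (θ : E) :
    IsOpen {p : E × ℝ | ∀ r ∈ Icc (0 : ℝ) 1, p.1 + (r * p.2) • θ ∈ Ω} := by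
  refine isOpen_iff_eventually.2 fun p hp => ?_
  refine isCompact_Icc.eventually_forall_of_forall_eventually fun r hr => ?_
  have hc : Continuous fun q : (E × ℝ) × ℝ => q.1.1 + (q.2 * q.1.2) • θ := by fun_prop
  exact hc.continuousAt.eventually (ho.mem_nhds (hp r hr))

/-- Integrated form of the weak derivative: along a.e. segment contained in `Ω`, `u` is a primitive
of `v`. -/
theorem ae_sub_eq_integral_of_isWeakDirDeriv {Ω : Set E} (ho : IsOpen Ω) {θ : E} {u v : E → ℝ}
    (hv : StronglyMeasurable v)
    (hu1 : Integrable (Ω.indicator u)) (hv1 : Integrable (Ω.indicator v))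
    (h : IsWeakDirDeriv Ω θ u v) {t : ℝ} (ht : 0 ≤ t) :
    ∀ᵐ x, (∀ r ∈ Icc (0 : ℝ) 1, x + (r * t) • θ ∈ Ω) →
      Ω.indicator u (x + t • θ) - Ω.indicator u x =
        ∫ s in (0 : ℝ)..t, Ω.indicator v (x + s • θ) := by
  set U := Ω.indicator u
  set V := Ω.indicator v
  have hVm : StronglyMeasurable V := hv.indicator ho.measurableSet
  have hO : IsOpen {x : E | ∀ r ∈ Icc (0 : ℝ) 1, x + (r * t) • θ ∈ Ω} :=
    (isOpen_segment_subset ho θ).preimage (by fun_prop : Continuous fun x : E => (x, t))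
  have hint : Integrable fun x => ∫ s in (0 : ℝ)..t, V (x + s • θ) := by
    simp_rw [intervalIntegral.integral_of_le ht]
    exact (integrable_prod_translate hVm hv1 θ t).integral_prod_left
  have hD : Integrable fun x => U (x + t • θ) - U x - ∫ s in (0 : ℝ)..t, V (x + s • θ) :=
    ((hu1.comp_add_right _).sub hu1).sub hint
  -- The set of `x` whose segment stays in `Ω` is open, so the fundamental lemma of the calculus of
  -- variations applies to test functions supported in it.
  have key := hO.ae_eq_zero_of_integral_contDiff_smul_eq_zero (hD.locallyIntegrable.locallyIntegrableOn _) ?_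
  · filter_upwards [key] with x hx hx'
    linarith [hx hx']
  intro φ hφ hc hs
  obtain ⟨C, hC⟩ := hφ.continuous.bounded_above_of_compact_support hc
  have hder : ∀ s ∈ uIcc 0 t,
      HasDerivAt (fun t : ℝ => ∫ x, U x * φ (x - t • θ)) (∫ x, V x * φ (x - s • θ)) s := by
    intro s hs'
    rw [uIcc_of_le ht] at hs'
    convert hasDerivAt_integral_translate hu1 hφ hc θ s using 1
    have hh : HasCompactSupport fun x => φ (x - s • θ) := by
      simpa [sub_eq_add_neg, Function.comp_def] using
        hc.comp_homeomorph (Homeomorph.addRight (-(s • θ)))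
    have h2 := h.2 (fun x => φ (x - s • θ)) (hφ.comp (contDiff_id.sub contDiff_const)) hh ?_
    · simp_rw [fderiv_comp_sub] at h2
      have e1 : ∀ f g : E → ℝ, ∫ x, Ω.indicator f x * g x = ∫ x in Ω, f x * g x := by
        intro f g
        rw [← integral_indicator ho.measurableSet]
        congr 1 with x
        by_cases hx : x ∈ Ω <;> simp [hx]
      simp only [U, V]
      simp_rw [mul_neg, integral_neg, e1]
      rw [h2, neg_neg]
    · have : tsupport (fun x => φ (x - s • θ)) ⊆ (fun x => x - s • θ) ⁻¹' tsupport φ :=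
        tsupport_comp_subset_preimage φ (by fun_prop)
      intro x hx
      have hx1 := hs (this hx)
      -- The segment of length `t` from `x - s • θ` passes through `x` at `r = s / t`; for `t = 0`
      -- also `s = 0`.
      rcases ht.eq_or_lt with h0 | h0
      · have := hx1 0 (by simp)
        have hs0 : s = 0 := by subst h0; exact le_antisymm hs'.2 hs'.1
        simpa [hs0] using this
      · have := hx1 (s / t) ⟨by have := hs'.1; positivity, by rw [div_le_one h0]; exact hs'.2⟩
        rwa [div_mul_cancel₀ _ h0.ne', sub_add_cancel] at this
  have ftc := intervalIntegral.integral_eq_sub_of_hasDerivAt hder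
    ((continuous_integral_translate hv1 hφ hc θ).intervalIntegrable _ _)
  rw [integral_integral_translate hVm hv1 hφ.continuous hc θ ht] at ftc
  simp only [integral_mul_translate_eq, zero_smul, add_zero] at ftc
  have i1 : ∀ f : E → ℝ, Integrable f → Integrable fun x => φ x * f x := fun f hf =>
    hf.bdd_mul hφ.continuous.aestronglyMeasurable (Eventually.of_forall hC)
  simp only [smul_eq_mul, mul_sub]
  rw [integral_sub (f := fun x => φ x * U (x + t • θ) - φ x * U x)
      ((i1 _ (hu1.comp_add_right _)).sub (i1 _ hu1)) (i1 _ hint),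
    integral_sub (i1 _ (hu1.comp_add_right _)) (i1 _ hu1), ftc, sub_self]

/-- Converse of the previous result, used on lines to show that slices are in `H¹`. A sequence of
lengths tending to `0` suffices, because only a derivative at `0` is computed; this keeps the
exceptional set of lines a countable union. -/
theorem isWeakDirDeriv_of_ae_sub_eq {Ω : Set E} (ho : IsOpen Ω) {θ : E} {u v : E → ℝ}
    (hv : StronglyMeasurable v)
    (hu1 : Integrable (Ω.indicator u)) (hv1 : Integrable (Ω.indicator v))
    (hv2 : MemLp v 2 (volume.restrict Ω)) {t : ℕ → ℝ} (ht : ∀ n, 0 < t n)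
    (ht0 : Tendsto t atTop (𝓝 0))
    (h : ∀ n, ∀ᵐ x, (∀ r ∈ Icc (0 : ℝ) 1, x + (r * t n) • θ ∈ Ω) →
      Ω.indicator u (x + t n • θ) - Ω.indicator u x =
        ∫ s in (0 : ℝ)..t n, Ω.indicator v (x + s • θ)) :
    IsWeakDirDeriv Ω θ u v := by
  refine ⟨hv2, fun φ hφ hc hs => ?_⟩
  set U := Ω.indicator u
  set V := Ω.indicator v
  have hVm : StronglyMeasurable V := hv.indicator ho.measurableSet
  obtain ⟨C, hC⟩ := hφ.continuous.bounded_above_of_compact_support hc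
  have i1 : ∀ f : E → ℝ, Integrable f → Integrable fun x => φ x * f x := fun f hf =>
    hf.bdd_mul hφ.continuous.aestronglyMeasurable (Eventually.of_forall hC)
  have hψ := continuous_integral_translate hv1 hφ hc θ
  have hd1 := hasDerivAt_integral_translate hu1 hφ hc θ 0
  have hd2 := (hψ.integral_hasStrictDerivAt 0 0).hasDerivAt
  have hd := hasDerivAt_iff_tendsto_slope.1 (hd1.sub hd2)
  have htn : Tendsto t atTop (𝓝[≠] 0) :=
    tendsto_nhdsWithin_iff.2 ⟨ht0, Eventually.of_forall fun n => (ht n).ne'⟩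
  have hev : ∀ᶠ n in atTop, ∀ x ∈ tsupport φ, ∀ r ∈ Icc (0 : ℝ) 1, x + (r * t n) • θ ∈ Ω := by
    refine ht0.eventually (p := fun s => ∀ x ∈ tsupport φ, ∀ r ∈ Icc (0 : ℝ) 1,
      x + (r * s) • θ ∈ Ω) (IsCompact.eventually_forall_of_forall_eventually hc fun x hx => ?_)
    have hcc : Continuous fun q : ℝ × E => (q.2, q.1) := by fun_prop
    refine hcc.continuousAt.eventually ((isOpen_segment_subset ho θ).mem_nhds ?_)
    intro r _
    simpa using hs hx
  -- Once `t n` is small, all segments starting in the support of `φ` stay in `Ω`, so the difference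
  -- quotients vanish; hence so does the derivative at `0`, and this is the weak derivative
  -- identity.
  have hzero := tendsto_nhds_unique (hd.comp htn) (tendsto_const_nhds.congr' (f₁ := fun _ => (0 : ℝ)) ?_)
  · have e1 : ∀ f g : E → ℝ, ∫ x, Ω.indicator f x * g x = ∫ x in Ω, f x * g x := by
      intro f g
      rw [← integral_indicator ho.measurableSet]
      congr 1 with x
      by_cases hx : x ∈ Ω <;> simp [hx]
    simp only [zero_smul, sub_zero, mul_neg, integral_neg] at hzero
    rw [← e1, ← e1]
    linarith
  · filter_upwards [hev] with n hn
    have e2 : ∫ x, φ x * U (x + t n • θ) - φ x * U x = ∫ x, φ x * ∫ s in (0 : ℝ)..t n, V (x + s • θ) := by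
      refine integral_congr_ae ?_
      filter_upwards [h n] with x hx
      by_cases hx0 : x ∈ tsupport φ
      · rw [← hx (hn x hx0), mul_sub]
      · simp [image_eq_zero_of_notMem_tsupport hx0]
    rw [integral_sub (i1 _ (hu1.comp_add_right _)) (i1 _ hu1),
      ← integral_integral_translate hVm hv1 hφ.continuous hc θ (ht n).le] at e2
    simp only [Function.comp, slope_def_field, Pi.sub_apply, intervalIntegral.integral_same]
    simp only [integral_mul_translate_eq U, zero_smul, add_zero]
    rw [← e2]
    simp

end Translation

/-! ### One-dimensional analysis on a chord. -/

/-- `U` and `V` are square integrable on `S ⊆ ℝ`, and `U` is, up to null sets, a primitive of `V`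
along the intervals contained in `S`. -/
structure IsSlicePrimitive (S : Set ℝ) (U V : ℝ → ℝ) : Prop where
  memLp_left : MemLp U 2 (volume.restrict S)
  memLp_right : MemLp V 2 (volume.restrict S)
  ae_sub_eq : ∀ᵐ s, ∀ᵐ r, s < r → Icc s r ⊆ S → U r - U s = ∫ x in s..r, V x

theorem IsSlicePrimitive.congr_left {S : Set ℝ} {U U' V : ℝ → ℝ} (h : IsSlicePrimitive S U V)
    (hU : ∀ᵐ s, s ∈ S → U' s = U s) (hS : MeasurableSet S) : IsSlicePrimitive S U' V := by
  refine ⟨h.memLp_left.ae_eq ?_, h.memLp_right, ?_⟩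
  · exact (ae_restrict_iff' hS).2 (hU.mono fun s hs hs' => (hs hs').symm)
  · filter_upwards [h.ae_sub_eq, hU] with s hs hs1
    filter_upwards [hs, hU] with r hr hr1 hsr hI
    rw [hr1 (hI (right_mem_Icc.2 hsr.le)), hs1 (hI (left_mem_Icc.2 hsr.le)), hr hsr hI]

/-- Cauchy-Schwarz, from the nonnegativity of the variance of `V` on the interval. -/
theorem sq_integral_le_mul_integral_sq {V : ℝ → ℝ} {a b : ℝ} (hab : a < b)
    (hV : MemLp V 2 (volume.restrict (Ioo a b))) :
    (∫ x in Ioo a b, V x) ^ 2 ≤ (b - a) * ∫ x in Ioo a b, V x ^ 2 := by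
  have h1 : Integrable V (volume.restrict (Ioo a b)) := hV.integrable one_le_two
  have h2 : Integrable (fun x => V x ^ 2) (volume.restrict (Ioo a b)) := hV.integrable_sq
  set I := ∫ x in Ioo a b, V x
  have h0 : 0 ≤ ∫ x in Ioo a b, (V x - I / (b - a)) ^ 2 :=
    integral_nonneg fun x => sq_nonneg _
  have e : ∫ x in Ioo a b, (V x - I / (b - a)) ^ 2 =
      (∫ x in Ioo a b, V x ^ 2) - 2 * (I / (b - a)) * I + (b - a) * (I / (b - a)) ^ 2 := by
    have : ∀ x, (V x - I / (b - a)) ^ 2 =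
        V x ^ 2 - 2 * (I / (b - a)) * V x + (I / (b - a)) ^ 2 := fun x => by ring
    simp_rw [this]
    rw [integral_add (f := fun x => V x ^ 2 - 2 * (I / (b - a)) * V x)
      (h2.sub (h1.const_mul _)) (integrable_const _),
      integral_sub h2 (h1.const_mul _), integral_const_mul, setIntegral_const]
    simp [Measure.real, hab.le, I]
  rw [e] at h0
  have hb : 0 < b - a := sub_pos.2 hab
  have e2 : (∫ x in Ioo a b, V x ^ 2) - 2 * (I / (b - a)) * I + (b - a) * (I / (b - a)) ^ 2 =
      (∫ x in Ioo a b, V x ^ 2) - I ^ 2 / (b - a) := by field_simp; ring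
  rw [e2, sub_nonneg, div_le_iff₀ hb] at h0
  linarith

section Component

variable {S : Set ℝ} {U V : ℝ → ℝ} {α β : ℝ}

theorem IsSlicePrimitive.exists_trace (h : IsSlicePrimitive S U V)
    (hc : IsComponentInterval S α β) :
    ∃ f : ℝ → ℝ, f =ᵐ[volume.restrict (Ioo α β)] U ∧ ContinuousOn f (Ioc α β) ∧
      ∀ r ∈ Ioc α β, f β - f r = ∫ x in r..β, V x := by
  obtain ⟨hab, hS, -, -⟩ := hc
  have hV2 : MemLp V 2 (volume.restrict (Ioo α β)) :=
    h.memLp_right.mono_measure (Measure.restrict_mono_set _ hS)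
  have hV : IntegrableOn V (Icc α β) :=
    (integrableOn_Icc_iff_integrableOn_Ioo).2 (hV2.integrable one_le_two)
  have hI : ∀ a ∈ Icc α β, ∀ b ∈ Icc α β, IntervalIntegrable V volume a b := fun a ha b hb =>
    (hV.mono_set (uIcc_subset_Icc ha hb)).intervalIntegrable
  have hmem : ∀ a, a ∈ Ioo α β → a ∈ Icc α β := fun a ha => Ioo_subset_Icc_self ha
  have hβ : β ∈ Icc α β := right_mem_Icc.2 hab.le
  -- If `U` is a primitive of `V`, this is its value at `β`; it remains to see that `H` is a.e.
  -- constant.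
  set H : ℝ → ℝ := fun r => U r + ∫ x in r..β, V x
  have hH : ∀ᵐ s, s ∈ Ioo α β → ∀ᵐ r, r ∈ Ioo s β → H r = H s := by
    filter_upwards [h.ae_sub_eq] with s hs hsI
    filter_upwards [hs] with r hr hrI
    have hrI' : r ∈ Ioo α β := ⟨hsI.1.trans hrI.1, hrI.2⟩
    have h1 := hr hrI.1 ((Icc_subset_Ioo hsI.1 hrI.2).trans hS)
    have h2 := intervalIntegral.integral_add_adjacent_intervals
      (hI s (hmem s hsI) r (hmem r hrI')) (hI r (hmem r hrI') β hβ)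
    simp only [H]
    linarith
  have hex : ∀ a b : ℝ, a < b → ∀ p : ℝ → Prop, (∀ᵐ s, p s) → ∃ s ∈ Ioo a b, p s := by
    intro a b hab p hp
    by_contra! hcon
    have : volume (Ioo a b) = 0 :=
      measure_mono_null (fun s hs => hcon s hs) (ae_iff.1 hp)
    simp [hab.not_ge] at this
  obtain ⟨s₁, hs₁, hs₁'⟩ := hex α β hab _ hH
  -- The hypothesis only compares `s` with points to its right, so `s` and `s₁` are compared through
  -- a common `r` beyond both.
  have hconst : ∀ᵐ s, s ∈ Ioo α β → H s = H s₁ := by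
    filter_upwards [hH] with s hs hsI
    obtain ⟨r, hr, hr'⟩ := hex (max s s₁) β (max_lt hsI.2 hs₁.2) _ ((hs hsI).and (hs₁' hs₁))
    rw [← hr'.1 ⟨(le_max_left _ _).trans_lt hr.1, hr.2⟩,
      hr'.2 ⟨(le_max_right _ _).trans_lt hr.1, hr.2⟩]
  refine ⟨fun r => H s₁ - ∫ x in r..β, V x, ?_, ?_, ?_⟩
  · refine (ae_restrict_iff' measurableSet_Ioo).2 ?_
    filter_upwards [hconst] with s hs hsI
    rw [← hs hsI]
    simp [H]
  · have := intervalIntegral.continuousOn_primitive_interval_left (μ := volume) (f := V) (a := α)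
      (b := β) (by rwa [uIcc_of_le hab.le])
    rw [uIcc_of_le hab.le] at this
    exact continuousOn_const.sub (this.mono Ioc_subset_Icc_self)
  · intro r _
    simp

theorem IsSlicePrimitive.intervalIntegrable (h : IsSlicePrimitive S U V)
    (hc : IsComponentInterval S α β) :
    IntervalIntegrable (fun s => U (β - s)) volume 0 (β - α) := by
  have h1 : IntervalIntegrable U volume α β := by
    refine (intervalIntegrable_iff_integrableOn_Ioo_of_le hc.1.le).2 ?_
    exact (h.memLp_left.mono_measure (Measure.restrict_mono_set _ hc.2.1)).integrable one_le_two
  simpa using (h1.comp_sub_left β).symm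

/-- `f` agrees up to `β` with the primitive of `V`, by continuity; each `U (β - s)` with `s < m`
then differs from `f β` by an integral of `V` over a length at most `m`, and averaging preserves the
bound. -/
theorem IsSlicePrimitive.sq_sub_average_le (h : IsSlicePrimitive S U V)
    (hc : IsComponentInterval S α β) {f : ℝ → ℝ}
    (hf : f =ᵐ[volume.restrict (Ioo α β)] U) (hfc : ContinuousOn f (Ioc α β)) {m : ℝ}
    (hm : 0 < m) (hmβ : m ≤ β - α) :
    (f β - 1 / m * ∫ s in (0 : ℝ)..m, U (β - s)) ^ 2 ≤ m * ∫ x in Ioo α β, V x ^ 2 := by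
  obtain ⟨f₀, hf₀, hfc₀, hV₀⟩ := h.exists_trace hc
  have heq : EqOn f f₀ (Ioc α β) := by
    refine Measure.eqOn_Ioc_of_ae_eq (μ := volume) ?_ hfc hfc₀
    rw [Measure.restrict_congr_set Ioo_ae_eq_Ioc.symm]
    exact hf.trans hf₀.symm
  have hV2 : MemLp V 2 (volume.restrict (Ioo α β)) :=
    h.memLp_right.mono_measure (Measure.restrict_mono_set _ hc.2.1)
  set K := ∫ x in Ioo α β, V x ^ 2
  have hK : 0 ≤ K := integral_nonneg fun x => sq_nonneg _
  have hUint : IntervalIntegrable (fun s => U (β - s)) volume 0 m := by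
    refine (h.intervalIntegrable hc).mono_set ?_
    rw [uIcc_of_le hm.le, uIcc_of_le (hm.le.trans hmβ)]
    exact Icc_subset_Icc_right hmβ
  have hU : ∀ᵐ s, s ∈ Ioo α β → f₀ s = U s := (ae_restrict_iff' measurableSet_Ioo).1 hf₀
  have hU' : ∀ᵐ s, β - s ∈ Ioo α β → f₀ (β - s) = U (β - s) :=
    (quasiMeasurePreserving_sub_left volume β).ae hU
  -- If `m = β - α`, the value `s = m` gives the endpoint `α`, where nothing is known.
  have hne : ∀ᵐ s : ℝ, s ≠ m := by simp [ae_iff]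
  have hbound : ∀ᵐ s, s ∈ uIoc 0 m → ‖f₀ β - U (β - s)‖ ≤ √(m * K) := by
    filter_upwards [hU', hne] with s hs hsm hsI
    rw [uIoc_of_le hm.le] at hsI
    have hs2 : s < m := lt_of_le_of_ne hsI.2 hsm
    have hs3 : β - s ∈ Ioo α β := ⟨by linarith, by linarith [hsI.1]⟩
    rw [← hs hs3, hV₀ _ (Ioo_subset_Ioc_self hs3), intervalIntegral.integral_of_le hs3.2.le,
      integral_Ioc_eq_integral_Ioo, Real.norm_eq_abs]
    refine Real.abs_le_sqrt ?_
    have hsub : Ioo (β - s) β ⊆ Ioo α β := Ioo_subset_Ioo_left hs3.1.le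
    refine (sq_integral_le_mul_integral_sq hs3.2
      (hV2.mono_measure (Measure.restrict_mono_set _ hsub))).trans ?_
    have hmono : ∫ x in Ioo (β - s) β, V x ^ 2 ≤ K :=
      setIntegral_mono_set hV2.integrable_sq (Eventually.of_forall fun x => sq_nonneg _)
        hsub.eventuallyLE
    have : β - (β - s) ≤ m := by linarith
    exact mul_le_mul this hmono (integral_nonneg fun x => sq_nonneg _) hm.le
  have hint := intervalIntegral.norm_integral_le_of_norm_le_const_ae hbound
  have e : f β - 1 / m * ∫ s in (0 : ℝ)..m, U (β - s) =
      (∫ s in (0 : ℝ)..m, (f₀ β - U (β - s))) / m := by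
    rw [intervalIntegral.integral_sub intervalIntegrable_const hUint, heq (right_mem_Ioc.2 hc.1)]
    simp
    field_simp
  rw [e, ← Real.sq_sqrt (mul_nonneg hm.le hK), sq_le_sq, abs_div, abs_of_pos hm,
    abs_of_nonneg (Real.sqrt_nonneg _), div_le_iff₀ hm]
  simpa [abs_of_pos hm] using hint

end Component

variable {d : ℕ}

/-! ### Chords, the directional boundary and their measurability. -/

section Geometry

variable {Ω : Set (EuclideanSpace ℝ (Fin d))} {θ : EuclideanSpace ℝ (Fin d)}

theorem chordLength_nonneg (z : EuclideanSpace ℝ (Fin d)) : 0 ≤ chordLength Ω θ z :=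
  Real.sSup_nonneg fun _ hs => hs.1

theorem bddAbove_chordLength (hb : Bornology.IsBounded Ω) (hθ : ‖θ‖ = 1)
    (z : EuclideanSpace ℝ (Fin d)) :
    BddAbove {s : ℝ | 0 ≤ s ∧ ∀ t ∈ Ioo 0 s, z - t • θ ∈ Ω} :=
  ⟨Metric.diam Ω, fun _ hs => le_diam_of_mem (θ := -θ) hb (by rwa [norm_neg]) fun t ht => by
    simpa [sub_eq_add_neg] using hs.2 t ht⟩

theorem nonempty_chordLength (z : EuclideanSpace ℝ (Fin d)) :
    {s : ℝ | 0 ≤ s ∧ ∀ t ∈ Ioo 0 s, z - t • θ ∈ Ω}.Nonempty :=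
  ⟨0, le_refl _, fun _ h => absurd (h.1.trans h.2) (lt_irrefl _)⟩

/-- For fixed `z` the open interval is exhausted by countably many compact ones, and membership of a
compact segment in `Ω` is an open condition on `z`; this makes the supremum measurable. -/
theorem lt_chordLength_iff (hb : Bornology.IsBounded Ω) (hθ : ‖θ‖ = 1)
    {z : EuclideanSpace ℝ (Fin d)} {c : ℝ} (hc : 0 ≤ c) :
    c < chordLength Ω θ z ↔ ∃ s : ℚ, c < s ∧ ∀ n : ℕ,
      ∀ t ∈ Icc (1 / ((n : ℝ) + 1)) (s - 1 / ((n : ℝ) + 1)), z - t • θ ∈ Ω := by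
  constructor
  · intro h
    obtain ⟨s, hs, hcs⟩ := exists_lt_of_lt_csSup (nonempty_chordLength z) h
    obtain ⟨q, hq, hqs⟩ := exists_rat_btwn hcs
    refine ⟨q, hq, fun n t ht => hs.2 t ?_⟩
    have : (0 : ℝ) < 1 / ((n : ℝ) + 1) := by positivity
    exact ⟨by linarith [ht.1], by linarith [ht.2]⟩
  · rintro ⟨s, hs, hn⟩
    refine hs.trans_le (le_csSup (bddAbove_chordLength hb hθ z) ⟨hc.trans hs.le, fun t ht => ?_⟩)
    obtain ⟨n, hn'⟩ := exists_nat_one_div_lt (lt_min ht.1 (sub_pos.2 ht.2))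
    refine hn n t ⟨(hn'.trans_le (min_le_left _ _)).le, ?_⟩
    have := hn'.trans_le (min_le_right _ _)
    linarith

theorem measurable_chordLength (ho : IsOpen Ω) (hb : Bornology.IsBounded Ω) (hθ : ‖θ‖ = 1) :
    Measurable (chordLength Ω θ) := by
  refine measurable_of_Ioi fun c => ?_
  rcases lt_or_ge c 0 with h0 | h0
  · convert MeasurableSet.univ
    exact eq_univ_of_forall fun z => h0.trans_le (chordLength_nonneg z)
  · have : chordLength Ω θ ⁻¹' Ioi c = ⋃ s : ℚ, ⋃ _ : c < s, ⋂ n : ℕ,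
        {z | ∀ t ∈ Icc (1 / ((n : ℝ) + 1)) (s - 1 / ((n : ℝ) + 1)), z - t • θ ∈ Ω} := by
      ext z
      simp only [mem_preimage, mem_Ioi, lt_chordLength_iff hb hθ h0, mem_iUnion, mem_iInter,
        mem_ofPred_eq, exists_prop]
    rw [this]
    refine MeasurableSet.iUnion fun s => MeasurableSet.iUnion fun _ => MeasurableSet.iInter fun n =>
      IsOpen.measurableSet ?_
    refine isOpen_iff_eventually.2 fun z hz => ?_
    refine isCompact_Icc.eventually_forall_of_forall_eventually fun t ht => ?_
    have hc : Continuous fun p : EuclideanSpace ℝ (Fin d) × ℝ => p.1 - p.2 • θ := by fun_prop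
    exact hc.continuousAt.eventually (ho.mem_nhds (hz t ht))

theorem isComponentInterval_of_mem_dirBoundary (ho : IsOpen Ω) (hb : Bornology.IsBounded Ω)
    (hθ : ‖θ‖ = 1) {y : EuclideanSpace ℝ (Fin d)} {β : ℝ} (hz : β • θ + y ∈ dirBoundary Ω θ) :
    IsComponentInterval (slice Ω θ y) (β - chordLength Ω θ (β • θ + y)) β := by
  obtain ⟨x, hx, hxz⟩ := hz
  have hℓ := chordLength_Phi ho hb hθ hx
  have hβ := add_delta_notMem ho hb hθ x
  have hα := add_delta_notMem (θ := -θ) ho hb (by rwa [norm_neg]) x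
  have h1 : 0 ≤ delta Ω θ x := delta_nonneg x
  have h2 : 0 ≤ delta Ω (-θ) x := delta_nonneg x
  rw [hxz] at hℓ hβ
  have hye : y = x - (β - delta Ω θ x) • θ := by
    rw [Phi] at hxz
    rw [← add_right_inj (β • θ), ← hxz]
    module
  have hpos : 0 < delta Ω θ x := by
    refine h1.lt_of_ne fun h => hβ ?_
    rw [← hxz, Phi, ← h]; simpa using hx
  have hα' : β - chordLength Ω θ (β • θ + y) ∉ slice Ω θ y := by
    intro h
    refine hα ?_
    rw [slice, mem_ofPred_eq, hℓ] at h
    rw [Phi]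
    convert h using 1
    rw [hye]
    module
  refine ⟨by rw [hℓ]; linarith, fun s hs => ?_, hα', hβ⟩
  rw [hℓ] at hs
  rw [slice, mem_ofPred_eq]
  rcases le_or_gt (β - delta Ω θ x) s with h | h
  · have := add_mem_of_lt_delta (Ω := Ω) (θ := θ) (x := x) (t := s - (β - delta Ω θ x))
      (by linarith) (by linarith [hs.2])
    convert this using 1
    rw [hye]
    module
  · have := add_mem_of_lt_delta (Ω := Ω) (θ := -θ) (x := x) (t := β - delta Ω θ x - s)
      (by linarith) (by linarith [hs.1])
    convert this using 1
    rw [hye]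
    module

theorem chordLength_of_isComponentInterval {y : EuclideanSpace ℝ (Fin d)} {α β : ℝ}
    (hc : IsComponentInterval (slice Ω θ y) α β) : chordLength Ω θ (β • θ + y) = β - α := by
  obtain ⟨hab, hS, hα, -⟩ := hc
  have e : ∀ t : ℝ, β • θ + y - t • θ = (β - t) • θ + y := fun t => by module
  refine IsGreatest.csSup_eq ⟨⟨by linarith, fun t ht => ?_⟩, fun s hs => ?_⟩
  · rw [e]
    exact hS ⟨by linarith [ht.2], by linarith [ht.1]⟩
  · by_contra! h
    have := hs.2 (β - α) ⟨by linarith, h⟩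
    rw [e, sub_sub_cancel] at this
    exact hα this

/-- `∂_θ Ω` is defined as an image, whose measurability is not evident; this description makes it an
intersection of measurable sets. -/
theorem mem_dirBoundary_iff (ho : IsOpen Ω) (hb : Bornology.IsBounded Ω) (hθ : ‖θ‖ = 1)
    {z : EuclideanSpace ℝ (Fin d)} :
    z ∈ dirBoundary Ω θ ↔ z ∉ Ω ∧ 0 < chordLength Ω θ z := by
  have e : (0 : ℝ) • θ + z = z := by simp
  constructor
  · intro hz
    have := isComponentInterval_of_mem_dirBoundary (β := 0) (y := z) ho hb hθ (by rwa [e])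
    rw [e] at this
    exact ⟨by simpa [slice] using this.2.2.2, by linarith [this.1]⟩
  · rintro ⟨hz, hℓ⟩
    obtain ⟨s, hs, hs0⟩ := exists_lt_of_lt_csSup (nonempty_chordLength z) hℓ
    -- From this point the ray along `θ` stays in `Ω` for exactly `s / 2` and leaves at `z ∉ Ω`.
    refine ⟨z - (s / 2) • θ, hs.2 _ ⟨by linarith, by linarith⟩, ?_⟩
    have hδ : delta Ω θ (z - (s / 2) • θ) = s / 2 := by
      refine IsGreatest.csSup_eq ⟨⟨by linarith, fun t ht => ?_⟩, fun r hr => ?_⟩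
      · have := hs.2 (s / 2 - t) ⟨by linarith [ht.2], by linarith [ht.1]⟩
        convert this using 1
        module
      · by_contra! h
        have := hr.2 (s / 2) ⟨by linarith, h⟩
        exact hz (by simpa using this)
    rw [Phi, hδ]
    module

theorem measurableSet_dirBoundary (ho : IsOpen Ω) (hb : Bornology.IsBounded Ω) (hθ : ‖θ‖ = 1) :
    MeasurableSet (dirBoundary Ω θ) := by
  have : dirBoundary Ω θ = Ωᶜ ∩ chordLength Ω θ ⁻¹' Ioi 0 := by
    ext z
    simp [mem_dirBoundary_iff ho hb hθ]
  rw [this]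
  exact ho.measurableSet.compl.inter (measurable_chordLength ho hb hθ measurableSet_Ioi)

theorem ae_mem_dirBoundary (ho : IsOpen Ω) (hb : Bornology.IsBounded Ω) (hθ : ‖θ‖ = 1) :
    ∀ᵐ z ∂(dirMeasure Ω θ), z ∈ dirBoundary Ω θ := by
  refine (ae_map_iff (measurable_Phi ho hb hθ).aemeasurable
    (measurableSet_dirBoundary ho hb hθ)).2 ?_
  exact (ae_restrict_iff' ho.measurableSet).2
    (Eventually.of_forall fun x hx => mem_image_of_mem _ hx)

theorem isOpen_slice (ho : IsOpen Ω) (y : EuclideanSpace ℝ (Fin d)) : IsOpen (slice Ω θ y) :=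
  ho.preimage (by fun_prop : Continuous fun s : ℝ => s • θ + y)

theorem volume_slice_le (hb : Bornology.IsBounded Ω) (hθ : ‖θ‖ = 1)
    (y : EuclideanSpace ℝ (Fin d)) :
    volume (slice Ω θ y) ≤ ENNReal.ofReal (Metric.diam Ω) := by
  refine (Real.volume_le_diam _).trans (Metric.ediam_le fun s hs t ht => ?_)
  rw [edist_dist]
  refine ENNReal.ofReal_le_ofReal ?_
  have := Metric.dist_le_diam_of_mem hb hs ht
  rwa [dist_add_right, dist_eq_norm, ← sub_smul, norm_smul, hθ, mul_one, ← dist_eq_norm] at this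

end Geometry

/-! ### Fubini along lines parallel to `θ`. -/

section Slicing

variable {θ : EuclideanSpace ℝ (Fin d)}

instance : (hypMeasure θ).IsAddHaarMeasure := by
  unfold hypMeasure; infer_instance

/-- The linear coordinates `(y, s) ↦ s θ + y` adapted to the unit vector `θ`. -/
noncomputable def hypCoord (θ : EuclideanSpace ℝ (Fin d)) (hθ : ‖θ‖ = 1) :
    (hyp θ × ℝ) ≃L[ℝ] EuclideanSpace ℝ (Fin d) :=
  LinearEquiv.toContinuousLinearEquiv <| LinearEquiv.ofBijective
    (LinearMap.coprod (hyp θ).subtype (LinearMap.toSpanSingleton ℝ _ θ)) <| by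
      have h1 : ⟪θ, θ⟫ = (1 : ℝ) := by rw [real_inner_self_eq_norm_sq, hθ, one_pow]
      constructor
      · refine (injective_iff_map_eq_zero _).2 ?_
        rintro ⟨⟨y, hy⟩, s⟩ h
        have hy' : ⟪θ, y⟫ = (0 : ℝ) := Submodule.mem_orthogonal_singleton_iff_inner_right.1 hy
        simp only [LinearMap.coprod_apply, Submodule.subtype_apply,
          LinearMap.toSpanSingleton_apply] at h
        have h2 : ⟪θ, y + s • θ⟫ = (0 : ℝ) := by rw [h, inner_zero_right]
        rw [inner_add_right, hy', inner_smul_right, h1, zero_add, mul_one] at h2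
        subst h2
        simpa using h
      · intro x
        refine ⟨(⟨x - ⟪θ, x⟫ • θ, ?_⟩, ⟪θ, x⟫), by simp⟩
        rw [Submodule.mem_orthogonal_singleton_iff_inner_right, inner_sub_right,
          inner_smul_right, h1, mul_one, sub_self]

theorem hypCoord_apply (hθ : ‖θ‖ = 1) (p : hyp θ × ℝ) :
    hypCoord θ hθ p = p.2 • θ + (p.1 : EuclideanSpace ℝ (Fin d)) := by
  rw [add_comm]; rfl

theorem smul_add_hypCoord_symm (hθ : ‖θ‖ = 1) (x : EuclideanSpace ℝ (Fin d)) :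
    ((hypCoord θ hθ).symm x).2 • θ + (((hypCoord θ hθ).symm x).1 : EuclideanSpace ℝ (Fin d)) = x := by
  rw [← hypCoord_apply hθ, ContinuousLinearEquiv.apply_symm_apply]

theorem hypCoord_symm_add_smul (hθ : ‖θ‖ = 1) (x : EuclideanSpace ℝ (Fin d)) (t : ℝ) :
    (hypCoord θ hθ).symm (x + t • θ) =
      (((hypCoord θ hθ).symm x).1, ((hypCoord θ hθ).symm x).2 + t) := by
  rw [ContinuousLinearEquiv.symm_apply_eq, hypCoord_apply]
  conv_lhs => rw [← smul_add_hypCoord_symm hθ x]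
  module

/-- By uniqueness of Haar measure. The value of the constant plays no role: only null sets and
finiteness of integrals are transferred to lines. -/
theorem exists_map_hypCoord (hθ : ‖θ‖ = 1) : ∃ c : NNReal,
    Measure.map (hypCoord θ hθ) ((hypMeasure θ).prod volume) = c • volume :=
  ⟨_, Measure.isAddLeftInvariant_eq_smul _ _⟩

theorem exists_volume_eq_smul_map (hθ : ‖θ‖ = 1) : ∃ c : NNReal,
    volume = c • Measure.map (hypCoord θ hθ) ((hypMeasure θ).prod volume) :=
  ⟨_, Measure.isAddLeftInvariant_eq_smul _ _⟩

theorem quasiMeasurePreserving_hypCoord (hθ : ‖θ‖ = 1) :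
    Measure.QuasiMeasurePreserving (hypCoord θ hθ) ((hypMeasure θ).prod volume) volume := by
  obtain ⟨c, hc⟩ := exists_map_hypCoord hθ
  refine ⟨(hypCoord θ hθ).continuous.measurable, ?_⟩
  rw [hc]
  exact Measure.smul_absolutelyContinuous

theorem quasiMeasurePreserving_hypCoord_symm_fst (hθ : ‖θ‖ = 1) :
    Measure.QuasiMeasurePreserving (fun x => ((hypCoord θ hθ).symm x).1) volume (hypMeasure θ) := by
  have hm : Measurable (fun x => ((hypCoord θ hθ).symm x).1) := by fun_prop
  refine ⟨hm, ?_⟩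
  obtain ⟨c, hc⟩ := exists_volume_eq_smul_map hθ
  rw [hc, Measure.map_smul,
    Measure.map_map hm (hypCoord θ hθ).continuous.measurable]
  refine Measure.smul_absolutelyContinuous.trans ?_
  have : (fun x => ((hypCoord θ hθ).symm x).1) ∘ hypCoord θ hθ = Prod.fst := by
    ext p : 1
    simp
  rw [this]
  exact Measure.quasiMeasurePreserving_fst.absolutelyContinuous

theorem ae_ae_line (hθ : ‖θ‖ = 1) {p : EuclideanSpace ℝ (Fin d) → Prop} (h : ∀ᵐ x, p x) :
    ∀ᵐ y : hyp θ ∂(hypMeasure θ), ∀ᵐ s : ℝ, p (s • θ + y) := by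
  have := Measure.ae_ae_of_ae_prod ((quasiMeasurePreserving_hypCoord hθ).ae h)
  simpa only [hypCoord_apply] using this

theorem ae_lintegral_line_lt_top (hθ : ‖θ‖ = 1) {f : EuclideanSpace ℝ (Fin d) → ENNReal}
    (hf : Measurable f) (h : ∫⁻ x, f x < ⊤) :
    ∀ᵐ y : hyp θ ∂(hypMeasure θ), ∫⁻ s : ℝ, f (s • θ + y) < ⊤ := by
  obtain ⟨c, hc⟩ := exists_map_hypCoord hθ
  have hm := (hypCoord θ hθ).continuous.measurable
  have h1 : ∫⁻ y : hyp θ, (∫⁻ s : ℝ, f (s • θ + y)) ∂(hypMeasure θ) < ⊤ := by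
    have e : ∫⁻ y : hyp θ, (∫⁻ s : ℝ, f (s • θ + y)) ∂(hypMeasure θ) =
        ∫⁻ p, f (hypCoord θ hθ p) ∂((hypMeasure θ).prod volume) := by
      rw [lintegral_prod (fun p => f (hypCoord θ hθ p)) (hf.comp hm).aemeasurable]
      simp only [hypCoord_apply]
    rw [e, ← lintegral_map hf hm, hc, lintegral_smul_measure]
    exact ENNReal.mul_lt_top ENNReal.coe_lt_top h
  refine ae_lt_top ?_ h1.ne
  have hmm : Measurable fun p : hyp θ × ℝ => f (p.2 • θ + p.1) := by
    simp only [← hypCoord_apply hθ]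
    exact hf.comp hm
  exact hmm.lintegral_prod_right'

theorem ae_memLp_slice {Ω : Set (EuclideanSpace ℝ (Fin d))} (ho : IsOpen Ω) (hθ : ‖θ‖ = 1)
    {u : EuclideanSpace ℝ (Fin d) → ℝ} (hm : StronglyMeasurable u)
    (hu : MemLp u 2 (volume.restrict Ω)) :
    ∀ᵐ y : hyp θ ∂(hypMeasure θ),
      MemLp (fun s : ℝ => u (s • θ + y)) 2 (volume.restrict (slice Ω θ y)) := by
  have h1 : ∫⁻ x, Ω.indicator (fun x => ‖u x‖ₑ ^ 2) x < ⊤ := by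
    rw [lintegral_indicator ho.measurableSet]
    have := (eLpNorm_lt_top_iff_lintegral_rpow_enorm_lt_top two_ne_zero ENNReal.ofNat_ne_top).1 hu.2
    simpa using this
  filter_upwards [ae_lintegral_line_lt_top hθ
    ((hm.measurable.enorm.pow_const 2).indicator ho.measurableSet) h1] with y hy
  refine ⟨(hm.comp_measurable (by fun_prop)).aestronglyMeasurable, ?_⟩
  refine (eLpNorm_lt_top_iff_lintegral_rpow_enorm_lt_top two_ne_zero ENNReal.ofNat_ne_top).2 ?_
  rw [← lintegral_indicator (isOpen_slice ho _).measurableSet]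
  refine lt_of_le_of_lt (le_of_eq ?_) hy
  congr 1 with s
  by_cases hs : s • θ + (y : EuclideanSpace ℝ (Fin d)) ∈ Ω
  · rw [indicator_of_mem hs, indicator_of_mem (show s ∈ slice Ω θ y from hs)]
    simp
  · rw [indicator_of_notMem hs, indicator_of_notMem (show s ∉ slice Ω θ y from hs)]

theorem stronglyMeasurable_integral_line {V : EuclideanSpace ℝ (Fin d) → ℝ}
    (hV : StronglyMeasurable V) (θ : EuclideanSpace ℝ (Fin d)) :
    StronglyMeasurable fun p : EuclideanSpace ℝ (Fin d) × ℝ =>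
      ∫ s in Ioc 0 p.2, V (p.1 + s • θ) := by
  have hs : MeasurableSet {q : (EuclideanSpace ℝ (Fin d) × ℝ) × ℝ | 0 < q.2 ∧ q.2 ≤ q.1.2} :=
    (measurableSet_lt measurable_const measurable_snd).inter
      (measurableSet_le measurable_snd (by fun_prop))
  have hF : StronglyMeasurable
      ({q : (EuclideanSpace ℝ (Fin d) × ℝ) × ℝ | 0 < q.2 ∧ q.2 ≤ q.1.2}.indicator
        fun q => V (q.1.1 + q.2 • θ)) :=
    (hV.comp_measurable (by fun_prop)).indicator hs
  convert hF.integral_prod_right' (ν := volume) using 1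
  ext p
  rw [← integral_indicator measurableSet_Ioc]
  rfl

theorem ae_isSlicePrimitive {Ω : Set (EuclideanSpace ℝ (Fin d))} (ho : IsOpen Ω)
    (hb : Bornology.IsBounded Ω) (hθ : ‖θ‖ = 1) {u v : EuclideanSpace ℝ (Fin d) → ℝ}
    (hum : StronglyMeasurable u) (hvm : StronglyMeasurable v)
    (hu : MemLp u 2 (volume.restrict Ω)) (h : IsWeakDirDeriv Ω θ u v) :
    ∀ᵐ y : hyp θ ∂(hypMeasure θ), IsSlicePrimitive (slice Ω θ y) (fun s => u (s • θ + y))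
        (fun s => v (s • θ + y)) ∧ MemH1Line (slice Ω θ y) (fun s => u (s • θ + y)) := by
  have : IsFiniteMeasure (volume.restrict Ω) := isFiniteMeasure_restrict.2 hb.measure_lt_top.ne
  have hu1 : Integrable (Ω.indicator u) :=
    (integrable_indicator_iff ho.measurableSet).2 (hu.integrable one_le_two)
  have hv1 : Integrable (Ω.indicator v) :=
    (integrable_indicator_iff ho.measurableSet).2 (h.1.integrable one_le_two)
  have hUm : StronglyMeasurable (Ω.indicator u) := hum.indicator ho.measurableSet
  have hVm : StronglyMeasurable (Ω.indicator v) := hvm.indicator ho.measurableSet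
  have key := fun {t : ℝ} (ht : 0 ≤ t) =>
    ae_sub_eq_integral_of_isWeakDirDeriv ho hvm hu1 hv1 h ht
  have hI := stronglyMeasurable_integral_line hVm θ
  -- The segment identity as a measurable predicate of the pair `(x, t)`, so that "for every `t`,
  -- a.e. `x`" can be exchanged into "for a.e. `x`, a.e. `t`".
  set P : EuclideanSpace ℝ (Fin d) × ℝ → Prop := fun p => 0 ≤ p.2 →
    (∀ r ∈ Icc (0 : ℝ) 1, p.1 + (r * p.2) • θ ∈ Ω) →
    Ω.indicator u (p.1 + p.2 • θ) - Ω.indicator u p.1 =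
      ∫ s in Ioc 0 p.2, Ω.indicator v (p.1 + s • θ)
  have hP : MeasurableSet {p | P p} := by
    refine (measurableSet_le measurable_const measurable_snd).imp
      ((isOpen_segment_subset ho θ).measurableSet.imp (measurableSet_eq_fun ?_ hI.measurable))
    exact (hUm.measurable.comp (by fun_prop)).sub (hUm.measurable.comp measurable_fst)
  have hall : ∀ᵐ x, ∀ᵐ t : ℝ, P (x, t) := by
    refine (Measure.ae_ae_comm (μ := volume) (ν := volume)
      (p := fun x t => P (x, t)) hP).2 (Eventually.of_forall fun t => ?_)
    rcases lt_or_ge t 0 with ht | ht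
    · exact Eventually.of_forall fun x h0 => absurd h0 ht.not_ge
    · filter_upwards [key ht] with x hx _ hseg
      rw [hx hseg, intervalIntegral.integral_of_le ht]
  -- The `H¹` property of the slice needs the identity at specific lengths tending to `0`, which an
  -- a.e. `t` statement does not provide.
  have hseq : ∀ᵐ x, ∀ n : ℕ, (∀ r ∈ Icc (0 : ℝ) 1, x + (r * (1 / ((n : ℝ) + 1))) • θ ∈ Ω) →
      Ω.indicator u (x + (1 / ((n : ℝ) + 1)) • θ) - Ω.indicator u x =
        ∫ s in (0 : ℝ)..(1 / ((n : ℝ) + 1)), Ω.indicator v (x + s • θ) :=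
    ae_all_iff.2 fun n => key (by positivity)
  filter_upwards [ae_memLp_slice ho hθ hum hu, ae_memLp_slice ho hθ hvm h.1, ae_ae_line hθ hall,
    ae_ae_line hθ hseq] with y hy1 hy2 hy3 hy4
  have hSo := isOpen_slice (θ := θ) ho y
  have hfin : IsFiniteMeasure (volume.restrict (slice Ω θ (y : EuclideanSpace ℝ (Fin d)))) :=
    isFiniteMeasure_restrict.2 ((volume_slice_le hb hθ _).trans_lt ENNReal.ofReal_lt_top).ne
  have esum : ∀ s t : ℝ, s • θ + (y : EuclideanSpace ℝ (Fin d)) + t • θ = (s + t) • θ + y :=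
    fun s t => by module
  have eind : ∀ (f : EuclideanSpace ℝ (Fin d) → ℝ) (s : ℝ),
      Ω.indicator f (s • θ + y) = (slice Ω θ y).indicator (fun s => f (s • θ + y)) s :=
    fun f s => rfl
  refine ⟨⟨hy1, hy2, ?_⟩, hy1, fun s => v (s • θ + y), ?_⟩
  · filter_upwards [hy3] with s hs
    have hs' : ∀ᵐ r : ℝ, P (s • θ + y, r - s) :=
      (measurePreserving_sub_right volume s).quasiMeasurePreserving.ae hs
    filter_upwards [hs'] with r hr hsr hI
    have hseg : ∀ q ∈ Icc (0 : ℝ) 1, s + q * (r - s) ∈ Icc s r := fun q hq =>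
      ⟨by nlinarith [hq.1], by nlinarith [hq.2]⟩
    have h1 := hr (sub_nonneg.2 hsr.le) fun q hq => by
      rw [esum]; exact hI (hseg q hq)
    simp only [esum, eind, add_sub_cancel] at h1
    rw [indicator_of_mem (hI (right_mem_Icc.2 hsr.le)),
      indicator_of_mem (hI (left_mem_Icc.2 hsr.le)),
      ← intervalIntegral.integral_of_le (sub_nonneg.2 hsr.le),
      intervalIntegral.integral_comp_add_left
        (fun s => (slice Ω θ y).indicator (fun s => v (s • θ + y)) s)] at h1
    simp only [add_zero, add_sub_cancel] at h1
    rw [h1]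
    refine intervalIntegral.integral_congr fun x hx => ?_
    rw [uIcc_of_le hsr.le] at hx
    exact indicator_of_mem (hI hx) _
  · refine isWeakDirDeriv_of_ae_sub_eq (t := fun n : ℕ => 1 / ((n : ℝ) + 1)) hSo
      (hvm.comp_measurable (by fun_prop))
      ((integrable_indicator_iff hSo.measurableSet).2 (hy1.integrable one_le_two))
      ((integrable_indicator_iff hSo.measurableSet).2 (hy2.integrable one_le_two)) hy2
      (fun n => by positivity) tendsto_one_div_add_atTop_nhds_zero_nat fun n => ?_
    filter_upwards [hy4] with s hs hseg
    have h1 := hs n fun r hr => by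
      rw [esum]; simpa [slice] using hseg r hr
    simp only [esum, eind] at h1
    simpa only [smul_eq_mul, mul_one] using h1

end Slicing

/-! ### Existence of traces and convergence of the averages. -/

section Trace

variable {Ω : Set (EuclideanSpace ℝ (Fin d))} {θ : EuclideanSpace ℝ (Fin d)}

theorem IsWeakDirDeriv.congr_ae {u v u' v' : EuclideanSpace ℝ (Fin d) → ℝ}
    (h : IsWeakDirDeriv Ω θ u v) (hu : u =ᵐ[volume.restrict Ω] u')
    (hv : v =ᵐ[volume.restrict Ω] v') : IsWeakDirDeriv Ω θ u' v' := by
  refine ⟨h.1.ae_eq hv, fun φ h1 h2 h3 => ?_⟩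
  have e1 : ∫ x in Ω, u x * fderiv ℝ φ x θ = ∫ x in Ω, u' x * fderiv ℝ φ x θ :=
    integral_congr_ae (hu.mul (ae_eq_refl _))
  have e2 : ∫ x in Ω, v x * φ x = ∫ x in Ω, v' x * φ x := integral_congr_ae (hv.mul (ae_eq_refl _))
  rw [← e1, ← e2]
  exact h.2 φ h1 h2 h3

/-- `Φ_θ` moves points along `θ` and leaves the hyperplane coordinate unchanged. Hence what holds on
a.e. line holds for `μ_θ`-a.e. endpoint. -/
theorem quasiMeasurePreserving_dirMeasure (ho : IsOpen Ω) (hb : Bornology.IsBounded Ω)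
    (hθ : ‖θ‖ = 1) :
    Measure.QuasiMeasurePreserving (fun z => ((hypCoord θ hθ).symm z).1) (dirMeasure Ω θ)
      (hypMeasure θ) := by
  have h := quasiMeasurePreserving_hypCoord_symm_fst hθ
  refine ⟨h.measurable, ?_⟩
  rw [dirMeasure, Measure.map_map h.measurable (measurable_Phi ho hb hθ)]
  have e : (fun z => ((hypCoord θ hθ).symm z).1) ∘ Phi Ω θ =
      fun z => ((hypCoord θ hθ).symm z).1 := by
    ext z : 1
    simp only [Function.comp, Phi, hypCoord_symm_add_smul]
  rw [e]
  exact (h.mono_left Measure.restrict_le_self.absolutelyContinuous).absolutelyContinuous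

section Slice

variable {y : EuclideanSpace ℝ (Fin d)} {α β : ℝ} {u : EuclideanSpace ℝ (Fin d) → ℝ}

theorem dirAverage_of_isComponentInterval (hc : IsComponentInterval (slice Ω θ y) α β)
    (u : EuclideanSpace ℝ (Fin d) → ℝ) (ε : ℝ) :
    dirAverage Ω θ u ε (β • θ + y) =
      1 / min ε (β - α) * ∫ s in (0 : ℝ)..min ε (β - α), u ((β - s) • θ + y) := by
  rw [dirAverage, chordLength_of_isComponentInterval hc]
  congr 2
  ext s
  congr 1
  module

theorem IsSlicePrimitive.sq_sub_dirAverage_le {V : ℝ → ℝ}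
    (h : IsSlicePrimitive (slice Ω θ y) (fun s => u (s • θ + y)) V)
    (hc : IsComponentInterval (slice Ω θ y) α β) {f : ℝ → ℝ}
    (hf : f =ᵐ[volume.restrict (Ioo α β)] fun s => u (s • θ + y))
    (hfc : ContinuousOn f (Ioc α β)) {ε : ℝ} (hε : 0 < ε) :
    (f β - dirAverage Ω θ u ε (β • θ + y)) ^ 2 ≤ ε * ∫ x in Ioo α β, V x ^ 2 := by
  rw [dirAverage_of_isComponentInterval hc]
  exact (h.sq_sub_average_le hc hf hfc (lt_min hε (sub_pos.2 hc.1)) (min_le_right _ _)).trans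
    (mul_le_mul_of_nonneg_right (min_le_left _ _) (integral_nonneg fun x => sq_nonneg _))

theorem tendsto_dirAverage_of_sq_sub_le {z : EuclideanSpace ℝ (Fin d)} {a K : ℝ}
    (h : ∀ ε : ℝ, 0 < ε → (a - dirAverage Ω θ u ε z) ^ 2 ≤ ε * K) :
    Tendsto (fun ε : ℝ => dirAverage Ω θ u ε z) (𝓝[>] 0) (𝓝 a) := by
  rw [tendsto_iff_norm_sub_tendsto_zero]
  have hlim : Tendsto (fun ε : ℝ => √(ε * K)) (𝓝[>] 0) (𝓝 0) := by
    have : Continuous fun ε : ℝ => √(ε * K) := by fun_prop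
    simpa using (this.tendsto 0).mono_left nhdsWithin_le_nhds
  refine squeeze_zero' (Eventually.of_forall fun _ => norm_nonneg _) ?_ hlim
  filter_upwards [self_mem_nhdsWithin] with ε hε
  rw [norm_sub_rev, Real.norm_eq_abs]
  exact Real.abs_le_sqrt (h ε hε)

end Slice

theorem mem_projSet_of_isComponentInterval (hθ : ‖θ‖ = 1) {y : hyp θ} {α β : ℝ}
    (hc : IsComponentInterval (slice Ω θ y) α β) : y ∈ projSet Ω θ := by
  refine ⟨((α + β) / 2) • θ + y, hc.2.1 ⟨by linarith [hc.1], by linarith [hc.1]⟩, ?_⟩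
  have hy : ⟪(y : EuclideanSpace ℝ (Fin d)), θ⟫ = (0 : ℝ) :=
    Submodule.mem_orthogonal_singleton_iff_inner_left.1 y.2
  rw [inner_add_left, hy, real_inner_smul_left, real_inner_self_eq_norm_sq, hθ]
  simp

/-- The representative in the definition of a trace can be replaced by `u` itself, since the two
agree a.e. on a.e. line. -/
theorem IsDirTrace.ae_exists_continuousOn (ho : IsOpen Ω) (hθ : ‖θ‖ = 1)
    {u g : EuclideanSpace ℝ (Fin d) → ℝ} (hg : IsDirTrace Ω θ u g) :
    ∀ᵐ y : hyp θ ∂(hypMeasure θ), ∀ α β : ℝ, IsComponentInterval (slice Ω θ y) α β →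
      ∃ f : ℝ → ℝ, f =ᵐ[volume.restrict (Ioo α β)] (fun s => u (s • θ + y)) ∧
        ContinuousOn f (Ioc α β) ∧ g (β • θ + y) = f β := by
  obtain ⟨w, hw, A, -, hA0, hA⟩ := hg
  have h1 : ∀ᵐ y : hyp θ ∂(hypMeasure θ), y ∉ projSet Ω θ \ A := measure_eq_zero_iff_ae_notMem.1 hA0
  filter_upwards [h1, ae_ae_line hθ ((ae_restrict_iff' ho.measurableSet).1 hw)] with y hy hyw α β hc
  have hyA : y ∈ A := by
    by_contra h
    exact hy ⟨mem_projSet_of_isComponentInterval hθ hc, h⟩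
  obtain ⟨f, hf, hfc, hfg⟩ := (hA y hyA).2 α β hc
  refine ⟨f, hf.trans ?_, hfc, hfg⟩
  refine (ae_restrict_iff' measurableSet_Ioo).2 ?_
  filter_upwards [hyw] with s hs hsI
  exact hs (hc.2.1 hsI)

theorem exists_isDirTrace (ho : IsOpen Ω) (hb : Bornology.IsBounded Ω) (hθ : ‖θ‖ = 1)
    {u : EuclideanSpace ℝ (Fin d) → ℝ} (hu : MemW Ω θ u) : ∃ g, IsDirTrace Ω θ u g := by
  obtain ⟨hu2, v, hv⟩ := hu
  set w := hu2.aestronglyMeasurable.mk u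
  have hwu : w =ᵐ[volume.restrict Ω] u := hu2.aestronglyMeasurable.ae_eq_mk.symm
  set v' := hv.1.aestronglyMeasurable.mk v
  have hvv : v' =ᵐ[volume.restrict Ω] v := hv.1.aestronglyMeasurable.ae_eq_mk.symm
  have hw : IsWeakDirDeriv Ω θ w v' := hv.congr_ae hwu.symm hvv.symm
  have key := ae_isSlicePrimitive ho hb hθ hu2.aestronglyMeasurable.stronglyMeasurable_mk
    hv.1.aestronglyMeasurable.stronglyMeasurable_mk (hu2.ae_eq hwu.symm) hw
  -- The limit of averages is a formula in `z` alone, so no choices on different lines have to be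
  -- glued; its values where no limit exists are immaterial.
  refine ⟨fun z => limUnder (𝓝[>] 0) fun ε : ℝ => dirAverage Ω θ w ε z, w, hwu,
    projSet Ω θ ∩ {y | IsSlicePrimitive (slice Ω θ y) (fun s => w (s • θ + y))
        (fun s => v' (s • θ + y)) ∧ MemH1Line (slice Ω θ y) (fun s => w (s • θ + y))},
    inter_subset_left, ?_, ?_⟩
  · rw [sdiff_self_inter]
    exact measure_mono_null (fun y hy => hy.2) (ae_iff.1 key)
  · rintro y ⟨-, hy, hyH⟩
    refine ⟨hyH, fun α β hc => ?_⟩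
    obtain ⟨f, hf, hfc, -⟩ := hy.exists_trace hc
    exact ⟨f, hf, hfc, (tendsto_dirAverage_of_sq_sub_le fun ε hε =>
      hy.sq_sub_dirAverage_le hc hf hfc hε).limUnder_eq⟩

/-- One exceptional set serves all `ε`, so the limit `ε → 0` can be taken at each remaining `z`. -/
theorem ae_dirMeasure_trace (ho : IsOpen Ω) (hb : Bornology.IsBounded Ω) (hθ : ‖θ‖ = 1)
    {u v g : EuclideanSpace ℝ (Fin d) → ℝ} (hu : MemLp u 2 (volume.restrict Ω))
    (hvm : StronglyMeasurable v) (hv : IsWeakDirDeriv Ω θ u v) (hg : IsDirTrace Ω θ u g) :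
    ∀ᵐ z ∂(dirMeasure Ω θ), z ∈ dirBoundary Ω θ →
      IntervalIntegrable (fun s : ℝ => u (z - s • θ)) volume 0 (chordLength Ω θ z) ∧
      ∀ (y : EuclideanSpace ℝ (Fin d)) (α β : ℝ), z = β • θ + y → y ∈ hyp θ →
        IsComponentInterval (slice Ω θ y) α β →
        IntegrableOn (fun s : ℝ => v (s • θ + y) ^ 2) (Ioo α β) ∧
        ∀ ε : ℝ, 0 < ε →
          (g z - dirAverage Ω θ u ε z) ^ 2 ≤ ε * ∫ s in Ioo α β, v (s • θ + y) ^ 2 := by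
  set w := hu.aestronglyMeasurable.mk u
  have hwu : w =ᵐ[volume.restrict Ω] u := hu.aestronglyMeasurable.ae_eq_mk.symm
  have hw : IsWeakDirDeriv Ω θ w v := hv.congr_ae hwu.symm (ae_eq_refl _)
  have key := ae_isSlicePrimitive ho hb hθ hu.aestronglyMeasurable.stronglyMeasurable_mk
    hvm (hu.ae_eq hwu.symm) hw
  have hline := ae_ae_line hθ ((ae_restrict_iff' ho.measurableSet).1 hwu)
  have hall := (key.and hline).and (hg.ae_exists_continuousOn ho hθ)
  filter_upwards [(quasiMeasurePreserving_dirMeasure ho hb hθ).ae hall] with z hz hzb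
  obtain ⟨⟨⟨hp, -⟩, hwy⟩, htr⟩ := hz
  set y₀ := ((hypCoord θ hθ).symm z).1
  set β₀ := ((hypCoord θ hθ).symm z).2
  have hz0 : β₀ • θ + (y₀ : EuclideanSpace ℝ (Fin d)) = z := smul_add_hypCoord_symm hθ z
  have hpu : IsSlicePrimitive (slice Ω θ y₀) (fun s => u (s • θ + y₀)) (fun s => v (s • θ + y₀)) :=
    hp.congr_left (hwy.mono fun s hs hsI => (hs hsI).symm) (isOpen_slice ho _).measurableSet
  constructor
  · have hc := isComponentInterval_of_mem_dirBoundary ho hb hθ (y := y₀) (β := β₀) (by rwa [hz0])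
    have := hpu.intervalIntegrable hc
    rw [hz0, sub_sub_cancel] at this
    convert this using 3 with s
    rw [← hz0]
    module
  · rintro y α β hzy hy hc
    have e : hypCoord θ hθ (⟨y, hy⟩, β) = z := by rw [hypCoord_apply, hzy]
    have e2 : (hypCoord θ hθ).symm z = (⟨y, hy⟩, β) := by
      rw [← e, ContinuousLinearEquiv.symm_apply_apply]
    have ey : (y₀ : EuclideanSpace ℝ (Fin d)) = y := by simp only [y₀, e2]
    rw [ey] at hpu htr
    refine ⟨(hpu.memLp_right.mono_measure
      (Measure.restrict_mono_set _ hc.2.1)).integrable_sq, fun ε hε => ?_⟩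
    obtain ⟨f, hf, hfc, hfg⟩ := htr α β hc
    rw [hzy, hfg]
    exact hpu.sq_sub_dirAverage_le hc hf hfc hε

theorem ae_dirMeasure_tendsto (ho : IsOpen Ω) (hb : Bornology.IsBounded Ω) (hθ : ‖θ‖ = 1)
    {u g : EuclideanSpace ℝ (Fin d) → ℝ} (hu : MemW Ω θ u) (hg : IsDirTrace Ω θ u g) :
    ∀ᵐ z ∂(dirMeasure Ω θ), z ∈ dirBoundary Ω θ →
      (0 < chordLength Ω θ z ∧
        IntervalIntegrable (fun s : ℝ => u (z - s • θ)) volume 0 (chordLength Ω θ z)) ∧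
      Tendsto (fun ε : ℝ => dirAverage Ω θ u ε z) (𝓝[>] 0) (𝓝 (g z)) := by
  obtain ⟨hu2, v, hv⟩ := hu
  obtain ⟨v', hv'm, hvv⟩ := hv.1.aestronglyMeasurable
  have hv' : IsWeakDirDeriv Ω θ u v' := hv.congr_ae (ae_eq_refl _) hvv
  filter_upwards [ae_dirMeasure_trace ho hb hθ hu2 hv'm hv' hg] with z hz hzb
  refine ⟨⟨((mem_dirBoundary_iff ho hb hθ).1 hzb).2, (hz hzb).1⟩, ?_⟩
  have hz0 := smul_add_hypCoord_symm hθ z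
  have hc := isComponentInterval_of_mem_dirBoundary ho hb hθ
    (y := ((hypCoord θ hθ).symm z).1) (β := ((hypCoord θ hθ).symm z).2) (by rwa [hz0])
  exact tendsto_dirAverage_of_sq_sub_le ((hz hzb).2 _ _ _ hz0.symm (Subtype.mem _) hc).2

theorem measurable_dirAverage (ho : IsOpen Ω) (hb : Bornology.IsBounded Ω) (hθ : ‖θ‖ = 1)
    {u : EuclideanSpace ℝ (Fin d) → ℝ} (hu : StronglyMeasurable u) {ε : ℝ} (hε : 0 ≤ ε) :
    Measurable (dirAverage Ω θ u ε) := by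
  have hm : Measurable fun z => min ε (chordLength Ω θ z) :=
    measurable_const.min (measurable_chordLength ho hb hθ)
  have h1 := (stronglyMeasurable_integral_line hu (-θ)).measurable.comp (measurable_id.prodMk hm)
  have : dirAverage Ω θ u ε = fun z => 1 / min ε (chordLength Ω θ z) *
      ∫ s in Ioc 0 (min ε (chordLength Ω θ z)), u (z + s • (-θ)) := by
    ext z
    rw [dirAverage, intervalIntegral.integral_of_le (le_min hε (chordLength_nonneg z))]
    simp [sub_eq_add_neg]
  rw [this]
  exact (hm.const_div 1).mul h1

/-- Changing `u` on a null set changes the averages only on a null set of endpoints, because a.e.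
line sees the change only on a null set of parameters. -/
theorem aemeasurable_dirAverage (ho : IsOpen Ω) (hb : Bornology.IsBounded Ω) (hθ : ‖θ‖ = 1)
    {u : EuclideanSpace ℝ (Fin d) → ℝ} (hu : AEStronglyMeasurable u (volume.restrict Ω)) {ε : ℝ}
    (hε : 0 < ε) : AEMeasurable (dirAverage Ω θ u ε) (dirMeasure Ω θ) := by
  obtain ⟨w, hwm, huw⟩ := hu
  refine ⟨dirAverage Ω θ w ε, measurable_dirAverage ho hb hθ hwm hε.le, ?_⟩
  have hline := ae_ae_line hθ ((ae_restrict_iff' ho.measurableSet).1 huw)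
  filter_upwards [(quasiMeasurePreserving_dirMeasure ho hb hθ).ae hline,
    ae_mem_dirBoundary ho hb hθ] with z hz hzb
  have hz0 := smul_add_hypCoord_symm hθ z
  set β := ((hypCoord θ hθ).symm z).2
  have hc := isComponentInterval_of_mem_dirBoundary ho hb hθ
    (y := ((hypCoord θ hθ).symm z).1) (β := β) (by rwa [hz0])
  rw [← hz0, dirAverage_of_isComponentInterval hc, dirAverage_of_isComponentInterval hc]
  congr 1
  refine intervalIntegral.integral_congr_ae ?_
  have h0 : (0 : ℝ) ≤ min ε (β - (β - chordLength Ω θ z)) := by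
    rw [sub_sub_cancel]
    exact le_min hε.le (chordLength_nonneg z)
  have hne : ∀ᵐ s : ℝ, s ≠ chordLength Ω θ z := by simp [ae_iff]
  filter_upwards [(quasiMeasurePreserving_sub_left volume β).ae hz, hne] with s hs hsne hsI
  rw [hz0, uIoc_of_le h0, sub_sub_cancel] at hsI
  refine hs (hc.2.1 ⟨?_, by linarith [hsI.1]⟩)
  have := lt_of_le_of_ne (hsI.2.trans (min_le_right _ _)) hsne
  rw [hz0]
  linarith

/-- No measurability is built into the notion of trace; it comes from `g` being an a.e. limit of
averages. -/
theorem aemeasurable_of_isDirTrace (ho : IsOpen Ω) (hb : Bornology.IsBounded Ω) (hθ : ‖θ‖ = 1)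
    {u g : EuclideanSpace ℝ (Fin d) → ℝ} (hu : MemW Ω θ u) (hg : IsDirTrace Ω θ u g) :
    AEMeasurable g (dirMeasure Ω θ) := by
  refine aemeasurable_of_tendsto_metrizable_ae (ι := ℕ) atTop
    (f := fun n => dirAverage Ω θ u (1 / ((n : ℝ) + 1)))
    (fun n => aemeasurable_dirAverage ho hb hθ hu.1.aestronglyMeasurable (by positivity)) ?_
  filter_upwards [ae_dirMeasure_tendsto ho hb hθ hu hg, ae_mem_dirBoundary ho hb hθ] with z hz hzb
  exact (hz hzb).2.comp (tendsto_nhdsWithin_iff.2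
    ⟨tendsto_one_div_add_atTop_nhds_zero_nat, Eventually.of_forall fun n => by
      simp only [mem_Ioi]; positivity⟩)

end Trace

/-! ### Integration of the chord estimate against `μ_θ`. -/

section Energy

variable {Ω : Set (EuclideanSpace ℝ (Fin d))} {θ : EuclideanSpace ℝ (Fin d)}

theorem delta_pos (ho : IsOpen Ω) (hb : Bornology.IsBounded Ω) (hθ : ‖θ‖ = 1)
    {x : EuclideanSpace ℝ (Fin d)} (hx : x ∈ Ω) : 0 < delta Ω θ x := by
  refine (delta_nonneg x).lt_of_ne fun h => add_delta_notMem ho hb hθ x ?_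
  rw [Phi, ← h]
  simpa using hx

/-- Every point of `Ω` is reached, along `θ`, from a set of points of length at most the diameter
of `Ω`. -/
theorem lintegral_lintegral_segment_le (ho : IsOpen Ω) (hb : Bornology.IsBounded Ω)
    (hθ : ‖θ‖ = 1) {f : EuclideanSpace ℝ (Fin d) → ENNReal} (hf : Measurable f) :
    ∫⁻ x, ∫⁻ t : ℝ, {p : EuclideanSpace ℝ (Fin d) × ℝ |
        ∀ r ∈ Icc (0 : ℝ) 1, p.1 + (r * p.2) • θ ∈ Ω}.indicator (fun p => f (p.1 + p.2 • θ)) (x, t) ≤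
      ENNReal.ofReal (Metric.diam Ω) * ∫⁻ x in Ω, f x := by
  set O := {p : EuclideanSpace ℝ (Fin d) × ℝ | ∀ r ∈ Icc (0 : ℝ) 1, p.1 + (r * p.2) • θ ∈ Ω}
  set k : EuclideanSpace ℝ (Fin d) × ℝ → ENNReal := O.indicator fun p => f (p.1 + p.2 • θ)
  have hk : Measurable k := by
    refine Measurable.indicator ?_ (isOpen_segment_subset ho θ).measurableSet
    exact hf.comp (by fun_prop)
  rw [lintegral_lintegral_swap (f := fun x t => k (x, t)) hk.aemeasurable]
  -- For fixed `t`, translation makes the endpoint of the segment the variable, so that `f` is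
  -- evaluated at `x` and only the set of admissible `t` remains to be measured.
  have h1 : ∀ t : ℝ, ∫⁻ x, k (x, t) = ∫⁻ x, k (x - t • θ, t) := fun t =>
    (lintegral_sub_right_eq_self (fun x => k (x, t)) (t • θ)).symm
  simp_rw [h1]
  rw [lintegral_lintegral_swap (f := fun (t : ℝ) x => k (x - t • θ, t))
    (hk.comp (by fun_prop : Measurable fun p : ℝ × EuclideanSpace ℝ (Fin d) =>
      (p.2 - p.1 • θ, p.1))).aemeasurable,
    ← lintegral_const_mul _ hf, ← lintegral_indicator ho.measurableSet]
  refine lintegral_mono fun x => ?_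
  by_cases hx : x ∈ Ω
  · rw [indicator_of_mem hx]
    have h2 : ∀ t : ℝ, k (x - t • θ, t) ≤ (slice Ω (-θ) x).indicator (fun _ => f x) t := by
      intro t
      by_cases ht : (x - t • θ, t) ∈ O
      · have h3 : t ∈ slice Ω (-θ) x := by
          have := ht 0 (by simp)
          simpa [slice, sub_eq_neg_add] using this
        simp only [k]
        rw [indicator_of_mem ht, indicator_of_mem h3, sub_add_cancel]
      · simp only [k]
        rw [indicator_of_notMem ht]
        exact zero_le
    refine (lintegral_mono h2).trans ?_
    rw [lintegral_indicator_const (isOpen_slice ho x).measurableSet, mul_comm]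
    gcongr
    exact volume_slice_le hb (by rwa [norm_neg]) x
  · refine le_of_eq_of_le (lintegral_eq_zero_of_ae_eq_zero (Eventually.of_forall fun t => ?_)) zero_le
    refine indicator_of_notMem (fun ht => hx ?_) _
    simpa using ht 1 (by simp)

theorem lintegral_sq_sub_dirAverage_le (ho : IsOpen Ω) (hb : Bornology.IsBounded Ω) (hθ : ‖θ‖ = 1)
    {u v g : EuclideanSpace ℝ (Fin d) → ℝ} (hu : MemLp u 2 (volume.restrict Ω))
    (hvm : StronglyMeasurable v) (hv : IsWeakDirDeriv Ω θ u v) (hg : IsDirTrace Ω θ u g)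
    {ε : ℝ} (hε : 0 < ε) :
    ∫⁻ z, ENNReal.ofReal ((g z - dirAverage Ω θ u ε z) ^ 2) ∂(dirMeasure Ω θ) ≤
      ENNReal.ofReal ε * (ENNReal.ofReal (Metric.diam Ω) *
        ∫⁻ x in Ω, ENNReal.ofReal (v x ^ 2)) := by
  have hΦ := measurable_Phi ho hb hθ
  have hF : AEMeasurable (fun z => g z - dirAverage Ω θ u ε z) (dirMeasure Ω θ) :=
    (aemeasurable_of_isDirTrace ho hb hθ ⟨hu, v, hv⟩ hg).sub
      (aemeasurable_dirAverage ho hb hθ hu.aestronglyMeasurable hε)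
  have hf : Measurable fun x => ENNReal.ofReal (v x ^ 2) :=
    (hvm.measurable.pow_const 2).ennreal_ofReal
  rw [dirMeasure, lintegral_map' (hF.pow_const 2).ennreal_ofReal hΦ.aemeasurable]
  refine le_trans ?_ (mul_le_mul_right (lintegral_lintegral_segment_le ho hb hθ hf) _)
  rw [← lintegral_const_mul' _ _ ENNReal.ofReal_ne_top]
  refine le_trans (lintegral_mono_ae ?_) (setLIntegral_le_lintegral Ω _)
  have hae := ae_of_ae_map hΦ.aemeasurable (ae_dirMeasure_trace ho hb hθ hu hvm hv hg)
  filter_upwards [hae, ae_restrict_mem ho.measurableSet] with x hx hxΩ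
  have hzb : Phi Ω θ x ∈ dirBoundary Ω θ := mem_image_of_mem _ hxΩ
  set y := ((hypCoord θ hθ).symm (Phi Ω θ x)).1
  set β := ((hypCoord θ hθ).symm (Phi Ω θ x)).2
  have hz0 : β • θ + (y : EuclideanSpace ℝ (Fin d)) = Phi Ω θ x := smul_add_hypCoord_symm hθ _
  have hc := isComponentInterval_of_mem_dirBoundary ho hb hθ (y := y) (β := β) (by rwa [hz0])
  obtain ⟨hint, hle⟩ := (hx hzb).2 y _ β hz0.symm y.2 hc
  set α := β - chordLength Ω θ (β • θ + y) with hα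
  have hx0 : x = (β - delta Ω θ x) • θ + y := by
    rw [sub_smul, sub_add_eq_add_sub, hz0, Phi, add_sub_cancel_right]
  rw [hz0, chordLength_Phi ho hb hθ hxΩ] at hα
  have hδ := delta_pos ho hb hθ hxΩ
  have hδ' := delta_pos (θ := -θ) ho hb (by rwa [norm_neg]) hxΩ
  -- The coordinate of `x` on its line; `s - σ` is then the signed distance from `x` to the point
  -- with coordinate `s`.
  set σ := β - delta Ω θ x with hσ
  have hσI : σ ∈ Ioo α β := ⟨by linarith, by linarith⟩
  refine (ENNReal.ofReal_le_ofReal (hle ε hε)).trans ?_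
  rw [ENNReal.ofReal_mul hε.le]
  gcongr
  rw [ofReal_integral_eq_lintegral_ofReal hint (Eventually.of_forall fun s => sq_nonneg _),
    ← lintegral_indicator measurableSet_Ioo]
  -- The chord integral is recentred at `x`; by convexity of the chord the whole segment from `x` to
  -- each of its points lies in `Ω`.
  refine le_of_le_of_eq (lintegral_mono fun s => ?_) (lintegral_sub_right_eq_self _ σ)
  by_cases hs : s ∈ Ioo α β
  · have hmem : (x, s - σ) ∈ {p : EuclideanSpace ℝ (Fin d) × ℝ |
        ∀ r ∈ Icc (0 : ℝ) 1, p.1 + (r * p.2) • θ ∈ Ω} := by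
      intro r hr
      have h1 : σ + r * (s - σ) ∈ Ioo α β := by
        have := (convex_Ioo α β).add_smul_sub_mem hσI hs hr
        simpa using this
      have h2 : (σ + r * (s - σ)) • θ + (y : EuclideanSpace ℝ (Fin d)) ∈ Ω := hc.2.1 h1
      convert h2 using 1
      simp only
      rw [hx0]
      module
    rw [indicator_of_mem hs, indicator_of_mem hmem]
    have : x + (s - σ) • θ = s • θ + y := by
      rw [hx0]
      module
    simp only [this, le_refl]
  · rw [indicator_of_notMem hs]
    exact zero_le

theorem memLp_and_integral_sq_sub_dirAverage_le (ho : IsOpen Ω) (hb : Bornology.IsBounded Ω)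
    (hθ : ‖θ‖ = 1) {u v g : EuclideanSpace ℝ (Fin d) → ℝ} (hu : MemLp u 2 (volume.restrict Ω))
    (hv : IsWeakDirDeriv Ω θ u v) (hg : IsDirTrace Ω θ u g) {ε : ℝ} (hε : 0 < ε) :
    MemLp (fun z => g z - dirAverage Ω θ u ε z) 2
        ((dirMeasure Ω θ).restrict (dirBoundary Ω θ)) ∧
      ∫ z in dirBoundary Ω θ, (g z - dirAverage Ω θ u ε z) ^ 2 ∂(dirMeasure Ω θ) ≤
        ε * Metric.diam Ω * ∫ x in Ω, v x ^ 2 := by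
  obtain ⟨w, hwm, hvw⟩ := hv.1.aestronglyMeasurable
  have hle := lintegral_sq_sub_dirAverage_le ho hb hθ hu hwm (hv.congr_ae (ae_eq_refl _) hvw) hg hε
  have e : ∫⁻ x in Ω, ENNReal.ofReal (w x ^ 2) = ENNReal.ofReal (∫ x in Ω, v x ^ 2) := by
    rw [ofReal_integral_eq_lintegral_ofReal hv.1.integrable_sq
      (Eventually.of_forall fun s => sq_nonneg _)]
    refine lintegral_congr_ae ?_
    filter_upwards [hvw] with x hx
    rw [hx]
  have hI : 0 ≤ ∫ x in Ω, v x ^ 2 := integral_nonneg fun x => sq_nonneg _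
  rw [e, ← ENNReal.ofReal_mul Metric.diam_nonneg, ← ENNReal.ofReal_mul hε.le, ← mul_assoc] at hle
  have hF : AEMeasurable (fun z => g z - dirAverage Ω θ u ε z)
      ((dirMeasure Ω θ).restrict (dirBoundary Ω θ)) :=
    ((aemeasurable_of_isDirTrace ho hb hθ ⟨hu, v, hv⟩ hg).sub
      (aemeasurable_dirAverage ho hb hθ hu.aestronglyMeasurable hε)).restrict
  have hle' := (setLIntegral_le_lintegral (dirBoundary Ω θ) _).trans hle
  constructor
  · refine ⟨hF.aestronglyMeasurable, ?_⟩
    refine (eLpNorm_lt_top_iff_lintegral_rpow_enorm_lt_top two_ne_zero ENNReal.ofNat_ne_top).2 ?_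
    refine lt_of_eq_of_lt (lintegral_congr fun z => ?_) (hle'.trans_lt ENNReal.ofReal_lt_top)
    rw [ENNReal.toReal_ofNat, ENNReal.rpow_ofNat, ← enorm_pow, Real.enorm_of_nonneg (sq_nonneg _)]
  · rw [integral_eq_lintegral_of_nonneg_ae (Eventually.of_forall fun s => sq_nonneg _)
      (hF.pow_const 2).aestronglyMeasurable]
    refine ENNReal.toReal_le_of_le_ofReal ?_ hle'
    have := Metric.diam_nonneg (s := Ω)
    positivity

end Energy

/-! ### From the gradient to directional derivatives. -/

section Gradient

variable {Ω : Set (EuclideanSpace ℝ (Fin d))}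

theorem IsWeakGrad.memLp {u : EuclideanSpace ℝ (Fin d) → ℝ}
    {G : EuclideanSpace ℝ (Fin d) → EuclideanSpace ℝ (Fin d)} (hG : IsWeakGrad Ω u G) :
    MemLp G 2 (volume.restrict Ω) :=
  MemLp.of_eval_piLp fun i => (hG i).1

theorem IsWeakGrad.isWeakDirDeriv (hb : Bornology.IsBounded Ω)
    {u : EuclideanSpace ℝ (Fin d) → ℝ} {G : EuclideanSpace ℝ (Fin d) → EuclideanSpace ℝ (Fin d)}
    (hu : MemLp u 2 (volume.restrict Ω)) (hG : IsWeakGrad Ω u G) (θ : EuclideanSpace ℝ (Fin d)) :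
    IsWeakDirDeriv Ω θ u fun x => ∑ i, θ i * G x i := by
  have : IsFiniteMeasure (volume.restrict Ω) := isFiniteMeasure_restrict.2 hb.measure_lt_top.ne
  refine ⟨memLp_finsetSum _ fun i _ => (hG i).1.const_mul _, fun φ hφ hc hs => ?_⟩
  obtain ⟨C, hC⟩ := hφ.continuous.bounded_above_of_compact_support hc
  have hθ : θ = ∑ i, θ i • EuclideanSpace.single i (1 : ℝ) := by
    simpa using ((EuclideanSpace.basisFun (Fin d) ℝ).sum_repr θ).symm
  have h1 : ∀ i, Integrable (fun x => θ i * (u x * fderiv ℝ φ x (EuclideanSpace.single i (1 : ℝ))))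
      (volume.restrict Ω) := fun i => by
    obtain ⟨D, hD⟩ := exists_bound_fderiv_apply hφ hc (EuclideanSpace.single i (1 : ℝ))
    refine ((hu.integrable one_le_two).mul_bdd (c := D) ?_ (Eventually.of_forall hD)).const_mul _
    exact ((hφ.continuous_fderiv (by simp)).clm_apply continuous_const).aestronglyMeasurable
  have h2 : ∀ i, Integrable (fun x => θ i * (G x i * φ x)) (volume.restrict Ω) := fun i =>
    (((hG i).1.integrable one_le_two).mul_bdd (c := C) hφ.continuous.aestronglyMeasurable
      (Eventually.of_forall hC)).const_mul _
  have e1 : ∀ x, u x * fderiv ℝ φ x θ =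
      ∑ i, θ i * (u x * fderiv ℝ φ x (EuclideanSpace.single i (1 : ℝ))) := fun x => by
    conv_lhs => rw [hθ]
    rw [map_sum, Finset.mul_sum]
    refine Finset.sum_congr rfl fun i _ => ?_
    rw [map_smul, smul_eq_mul]
    ring
  have e2 : ∀ x, (∑ i, θ i * G x i) * φ x = ∑ i, θ i * (G x i * φ x) := fun x => by
    rw [Finset.sum_mul]
    exact Finset.sum_congr rfl fun i _ => by ring
  simp_rw [e1, e2]
  rw [integral_finsetSum _ fun i _ => h1 i, integral_finsetSum _ fun i _ => h2 i,
    ← Finset.sum_neg_distrib]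
  refine Finset.sum_congr rfl fun i _ => ?_
  rw [integral_const_mul, integral_const_mul, (hG i).2 φ hφ hc hs, mul_neg]

/-- Pointwise Cauchy-Schwarz with `‖θ‖ = 1`; the resulting bound does not depend on `θ`, which gives
the uniformity over directions. -/
theorem integral_sq_sum_le {u : EuclideanSpace ℝ (Fin d) → ℝ}
    {G : EuclideanSpace ℝ (Fin d) → EuclideanSpace ℝ (Fin d)} (hG : IsWeakGrad Ω u G)
    {θ : EuclideanSpace ℝ (Fin d)} (hθ : ‖θ‖ = 1) :
    ∫ x in Ω, (∑ i, θ i * G x i) ^ 2 ≤ ∫ x in Ω, ‖G x‖ ^ 2 := by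
  refine integral_mono_of_nonneg (Eventually.of_forall fun x => sq_nonneg _)
    hG.memLp.norm.integrable_sq (Eventually.of_forall fun x => ?_)
  have h1 : ∑ i, θ i * G x i = ⟪G x, θ⟫ := by
    simp [PiLp.inner_apply]
  simp only [h1]
  rw [sq_le_sq, abs_norm]
  simpa [hθ] using abs_real_inner_le_norm (G x) θ

end Gradient

end DirTrace

theorem mainTheorem8 (d : ℕ) (hd : 1 ≤ d) (Ω : Set (EuclideanSpace ℝ (Fin d)))
    (hΩo : IsOpen Ω) (hΩb : Bornology.IsBounded Ω) :
    -- a fixed direction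
    (∀ θ ∈ Metric.sphere (0 : EuclideanSpace ℝ (Fin d)) 1,
      ∀ u : EuclideanSpace ℝ (Fin d) → ℝ, DirTrace.MemW Ω θ u →
        (∃ g, DirTrace.IsDirTrace Ω θ u g) ∧
        (∀ᵐ z ∂(DirTrace.dirMeasure Ω θ), z ∈ DirTrace.dirBoundary Ω θ →
          0 < DirTrace.chordLength Ω θ z ∧
          IntervalIntegrable (fun s : ℝ => u (z - s • θ)) volume 0 (DirTrace.chordLength Ω θ z)) ∧
        ∀ g, DirTrace.IsDirTrace Ω θ u g →
          (∀ᵐ z ∂(DirTrace.dirMeasure Ω θ), z ∈ DirTrace.dirBoundary Ω θ →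
            Tendsto (fun ε : ℝ => DirTrace.dirAverage Ω θ u ε z) (𝓝[>] 0) (𝓝 (g z))) ∧
          ∀ v, DirTrace.IsWeakDirDeriv Ω θ u v → ∀ ε : ℝ, 0 < ε →
            MemLp (fun z => g z - DirTrace.dirAverage Ω θ u ε z) 2
              ((DirTrace.dirMeasure Ω θ).restrict (DirTrace.dirBoundary Ω θ)) ∧
            ∫ z in DirTrace.dirBoundary Ω θ, (g z - DirTrace.dirAverage Ω θ u ε z) ^ 2
                ∂(DirTrace.dirMeasure Ω θ)
              ≤ ε * Metric.diam Ω * ∫ x in Ω, v x ^ 2) ∧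
    -- all directions
    (∀ u : EuclideanSpace ℝ (Fin d) → ℝ, DirTrace.MemH1tr Ω u →
      ∀ g, DirTrace.IsOmniTrace Ω u g →
        (∀ θ ∈ Metric.sphere (0 : EuclideanSpace ℝ (Fin d)) 1,
          ∀ᵐ z ∂(DirTrace.dirMeasure Ω θ), z ∈ DirTrace.dirBoundary Ω θ →
            (0 < DirTrace.chordLength Ω θ z ∧
            IntervalIntegrable (fun s : ℝ => u (z - s • θ)) volume 0
              (DirTrace.chordLength Ω θ z)) ∧
            Tendsto (fun ε : ℝ => DirTrace.dirAverage Ω θ u ε z) (𝓝[>] 0) (𝓝 (g z))) ∧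
        ∀ G, DirTrace.IsWeakGrad Ω u G → ∀ ε : ℝ, 0 < ε →
          ∀ θ ∈ Metric.sphere (0 : EuclideanSpace ℝ (Fin d)) 1,
            MemLp (fun z => g z - DirTrace.dirAverage Ω θ u ε z) 2
              ((DirTrace.dirMeasure Ω θ).restrict (DirTrace.dirBoundary Ω θ)) ∧
            ∫ z in DirTrace.dirBoundary Ω θ, (g z - DirTrace.dirAverage Ω θ u ε z) ^ 2
                ∂(DirTrace.dirMeasure Ω θ)
              ≤ ε * Metric.diam Ω * ∫ x in Ω, ‖G x‖ ^ 2) := by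
  refine ⟨fun θ hθ u hu => ?_, fun u hu g hg => ?_⟩
  · have hθ' : ‖θ‖ = 1 := mem_sphere_zero_iff_norm.1 hθ
    have hex := DirTrace.exists_isDirTrace hΩo hΩb hθ' hu
    refine ⟨hex, ?_, fun g hg => ⟨?_, fun v hv ε hε => ?_⟩⟩
    · obtain ⟨g, hg⟩ := hex
      filter_upwards [DirTrace.ae_dirMeasure_tendsto hΩo hΩb hθ' hu hg] with z hz hzb
      exact (hz hzb).1
    · filter_upwards [DirTrace.ae_dirMeasure_tendsto hΩo hΩb hθ' hu hg] with z hz hzb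
      exact (hz hzb).2
    · exact DirTrace.memLp_and_integral_sq_sub_dirAverage_le hΩo hΩb hθ' hu.1 hv hg hε
  · have hu2 := hu.1.1
    refine ⟨fun θ hθ => ?_, fun G hG ε hε θ hθ => ?_⟩
    · have hθ' : ‖θ‖ = 1 := mem_sphere_zero_iff_norm.1 hθ
      obtain ⟨G, hG⟩ := hu.1.2
      obtain ⟨γ, hγ, hγg⟩ := hg.2 θ hθ
      filter_upwards [DirTrace.ae_dirMeasure_tendsto hΩo hΩb hθ'
        ⟨hu2, _, hG.isWeakDirDeriv hΩb hu2 θ⟩ hγ, hγg] with z hz hzg hzb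
      exact hzg ▸ hz hzb
    · have hθ' : ‖θ‖ = 1 := mem_sphere_zero_iff_norm.1 hθ
      obtain ⟨γ, hγ, hγg⟩ := hg.2 θ hθ
      obtain ⟨h1, h2⟩ := DirTrace.memLp_and_integral_sq_sub_dirAverage_le hΩo hΩb hθ' hu2
        (hG.isWeakDirDeriv hΩb hu2 θ) hγ hε
      -- The estimate is known for a directional trace `γ`, which depends on `θ`; it passes to `g`
      -- because the two agree `μ_θ`-a.e.
      have hae : (fun z => γ z - DirTrace.dirAverage Ω θ u ε z)
          =ᵐ[(DirTrace.dirMeasure Ω θ).restrict (DirTrace.dirBoundary Ω θ)]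
          fun z => g z - DirTrace.dirAverage Ω θ u ε z := by
        filter_upwards [ae_restrict_of_ae hγg] with z hz
        rw [hz]
      refine ⟨h1.ae_eq hae, ?_⟩
      refine (integral_congr_ae (hae.symm.fun_comp fun t => t ^ 2)).trans_le ?_
      refine h2.trans (mul_le_mul_of_nonneg_left (DirTrace.integral_sq_sum_le hG hθ') ?_)
      exact mul_nonneg hε.le Metric.diam_nonneg
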